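/- All graphs are finite, simple and undirected, and distances between vertices in different components are infinite. A vertex set $X\subseteq V(G)$ is $3$-independent if any two distinct vertices of $X$ have distance at least $4$ in $G$. An instance of Dominating Set above $3$-independence is a triple $(G,X,p)$ where $G$ is a graph, $X$ is an inclusion-wise maximal $3$-independent set of $G$, and $p\ge 0$ is an integer; the question is whether $G$ has a dominating set of size exactly $p$; the parameter is $k=|R|$, where $R=V(G)\setminus N[X]$ is the residual set and $N[X]$ is the closed neighbourhood of $X$. Instances are encoded as words over a finite alphabet, with $G$ given by its adjacency matrix, $X$ by its characteristic vector and $p$ in binary. Then Dominating Set above $3$-independence is in $\mathsf{XP}$: there are a computable function $f\colon\mathbb N\to\mathbb N$ and a single (multi-stack) Turing machine that, on the encoding $w$ of any instance $(G,X,p)$, gives the correct yes/no answer after at most $|w|^{f(|R|)}+f(|R|)$ steps; moreover, whenever $n=|V(G)|\ge 2$ and $p\le n$, it does so after at most $n^{f(|R|)}$ steps. -/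

import Mathlib

/-! ### Parameterised decision problems and XP algorithms -/

/-- A parameterised decision problem: instances, an injective encoding of the instances as words
over a finite alphabet, the yes-instances, and the parameter of an instance. -/
structure ParamProblem where
  Instance : Type
  Alphabet : Type
  alphabetFinite : Finite Alphabet
  encode : Instance → List Alphabet
  encode_injective : Function.Injective encode
  IsYes : Instance → Prop
  param : Instance → ℕ

namespace ParamProblem

open Classical in
/-- The multi-stack Turing machine `M`, started on the encoding of the instance `I`, halts after at
most `t` steps with the one-symbol output `true` if `I` is a yes-instance and `false` if not. -/
def AnswersWithin (P : ParamProblem) (M : Turing.TM2ComputableAux P.Alphabet Bool)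
    (I : P.Instance) (t : ℕ) : Prop :=
  Nonempty (Turing.TM2OutputsInTime M.tm
    ((P.encode I).map M.inputAlphabet.invFun)
    (some ([decide (P.IsYes I)].map M.outputAlphabet.invFun)) t)

/-- The one machine `M` (all of whose stack alphabets are finite) solves every instance of `P`, with
encoding `w` and parameter `k`, in at most `|w| ^ f k + f k` steps, where `f` is computable.
The problem `P` belongs to the class XP if and only if such `M` and `f` exist. -/
def IsXPAlgorithm (P : ParamProblem) (M : Turing.TM2ComputableAux P.Alphabet Bool)
    (f : ℕ → ℕ) : Prop :=
  Computable f ∧ (∀ k, Finite (M.tm.Γ k)) ∧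
    ∀ I : P.Instance,
      P.AnswersWithin M I ((P.encode I).length ^ f (P.param I) + f (P.param I))

end ParamProblem

/-! ### Domination and independence in graphs -/

namespace SimpleGraph

variable {V : Type*}

/-- `X` is `r`-independent: distinct vertices of `X` have distance at least `r + 1`
(the distance of vertices in different components is infinite). -/
def IsRIndependent (G : SimpleGraph V) (r : ℕ) (X : Finset V) : Prop :=
  ∀ u ∈ X, ∀ v ∈ X, u ≠ v → (r : ℕ∞) + 1 ≤ G.edist u v

/-- The closed neighbourhood `N[X]`. -/
def closedNbhd (G : SimpleGraph V) (X : Finset V) : Set V :=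
  {v | v ∈ X ∨ ∃ x ∈ X, G.Adj x v}

/-- The residual set `V(G) \ N[X]`. -/
def residual (G : SimpleGraph V) (X : Finset V) : Set V :=
  (G.closedNbhd X)ᶜ

/-- `D` is a dominating set: the closed neighbourhood of every vertex meets `D`. -/
def IsDominatingSet (G : SimpleGraph V) (D : Finset V) : Prop :=
  ∀ v, ∃ u ∈ D, u = v ∨ G.Adj v u

end SimpleGraph

/-! ### Dominating Set above `r`-independence -/

/-- An instance: a finite graph `G` (on the vertices `0, …, n - 1`), an inclusion-wise maximal
`r`-independent set `X` of `G`, and a number `p`. -/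
structure DomSetInstance (r : ℕ) where
  n : ℕ
  G : SimpleGraph (Fin n)
  X : Finset (Fin n)
  maximal : Maximal (G.IsRIndependent r) X
  p : ℕ

namespace DomSetInstance

variable {r : ℕ}

open Classical in
/-- The characteristic word of a set of vertices. -/
noncomputable def bits {n : ℕ} (s : Fin n → Prop) : List (Option Bool) :=
  List.ofFn fun i => some (decide (s i))

/-- The instance as the word `1ⁿ # A₀ # ⋯ # Aₙ₋₁ # x # b` over the alphabet `{0, 1, #}`, where `#` is
`none`, `Aᵢ` is row `i` of the adjacency matrix of `G`, `x` is the characteristic word of `X` and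
`b` is the binary representation of `p`, least significant digit first. -/
noncomputable def encode (I : DomSetInstance r) : List (Option Bool) :=
  List.replicate I.n (some true) ++ [none]
    ++ (List.ofFn fun i => bits (I.G.Adj i) ++ [none]).flatten
    ++ bits (· ∈ I.X) ++ [none]
    ++ (Computability.encodeNat I.p).map some

end DomSetInstance

namespace DomSetInstance
variable {r : ℕ}

theorem bits_length {n : ℕ} (s : Fin n → Prop) : (bits s).length = n := by
  simp [bits]

theorem bits_injective {n : ℕ} : Function.Injective (bits (n := n)) := by
  intro s t h
  funext i
  have := congrFun (List.ofFn_injective h) i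
  simpa using this

theorem replicate_sep_inj {m n : ℕ} {u v : List (Option Bool)}
    (h : List.replicate m (some true) ++ none :: u = List.replicate n (some true) ++ none :: v) :
    m = n ∧ u = v := by
  induction m generalizing n with
  | zero => cases n <;> simp_all [List.replicate_succ]
  | succ m ih =>
    cases n with
    | zero => simp [List.replicate_succ] at h
    | succ n =>
      simp only [List.replicate_succ, List.cons_append, List.cons.injEq, true_and] at h
      simpa using ih h

theorem flatten_append_inj {n k : ℕ} {a b : Fin n → List (Option Bool)}
    (ha : ∀ i, (a i).length = k) (hb : ∀ i, (b i).length = k) {u v : List (Option Bool)}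
    (h : (List.ofFn a).flatten ++ u = (List.ofFn b).flatten ++ v) : a = b ∧ u = v := by
  induction n with
  | zero => exact ⟨Subsingleton.elim _ _, by simpa using h⟩
  | succ n ih =>
    simp only [List.ofFn_succ, List.flatten_cons, List.append_assoc] at h
    obtain ⟨h0, h1⟩ := List.append_inj h (by rw [ha, hb])
    obtain ⟨h2, h3⟩ := ih (fun i => ha i.succ) (fun i => hb i.succ) h1
    refine ⟨funext fun i => ?_, h3⟩
    refine Fin.cases h0 (fun j => congrFun h2 j) i

theorem encode_injective : Function.Injective (encode (r := r)) := by
  rintro ⟨m, G, X, hX, p⟩ ⟨n, H, Y, hY, q⟩ h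
  simp only [encode, List.append_assoc, List.singleton_append] at h
  obtain ⟨rfl, h⟩ := replicate_sep_inj h
  obtain ⟨h1, h⟩ := flatten_append_inj (k := m + 1) (by simp [bits_length])
    (by simp [bits_length]) h
  obtain ⟨h2, h⟩ := List.append_inj h (by simp [bits_length])
  obtain rfl : G = H := by
    ext i j
    have := congrFun h1 i
    simp only [List.append_cancel_right_eq] at this
    exact iff_of_eq (congrFun (bits_injective this) j)
  obtain rfl : X = Y := by
    ext i
    exact iff_of_eq (congrFun (bits_injective h2) i)
  have h4 : Computability.encodeNat p = Computability.encodeNat q := by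
    exact List.map_injective_iff.2 (Option.some_injective _) (by simpa using h)
  obtain rfl : p = q := by
    rw [← Computability.decode_encodeNat p, h4, Computability.decode_encodeNat]
  rfl

end DomSetInstance

/-- Dominating Set above `r`-independence, parameterised by the size of the residual set: does `G`
have a dominating set of size `p`? -/
noncomputable def dominatingSetAbove (r : ℕ) : ParamProblem where
  Instance := DomSetInstance r
  Alphabet := Option Bool
  alphabetFinite := inferInstance
  encode := DomSetInstance.encode
  encode_injective := DomSetInstance.encode_injective
  IsYes I := ∃ D : Finset (Fin I.n), D.card = I.p ∧ I.G.IsDominatingSet D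
  param I := (I.G.residual I.X).ncard

/-!
Dominating Set above `3`-independence is in XP because some optimal dominating set is close to `X`.
Since `X` is `3`-independent, the closed neighbourhoods of its vertices are disjoint and not joined
by edges, so every dominating set has a vertex in each of them, while `X` and the `k` residual
vertices together dominate `G`. Among all dominating sets that have at most `|X| + k` vertices and
are not larger than a given one, let `D` be one that is as close to `X` as possible. At most `k` of
the closed neighbourhoods contain two or more vertices of `D`. If `D` has exactly one vertex `d` in
`N[x]` and `d ≠ x`, then `d` cannot be replaced by `x`, so some residual vertex is dominated by `d`
alone, and this happens for at most `k` vertices `x`. Hence `D` differs from `X` in at most `5k`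
vertices (`SimpleGraph.IsDominatingSet.exists_near`). It follows that `G` has a dominating set of
size `p` if and only if `p ≤ n` and some set `D` that differs from `X` in at most `5k` vertices can
be completed, by the vertices without neighbour in `D`, to a set of size at most `p`
(`SimpleGraph.exists_isDominatingSet_card_eq_iff`).

There are at most `(n + 1) ^ (5k)` such sets `D`, and the machine goes through them by a depth-first
search over the bits of the characteristic word of `X`. The machine is compiled from a structured
program on stacks (`StackProg`), whose big-step semantics `StackProg.Exec` counts the steps of the
machine (`StackProg.Exec.mReach`, `StackProg.Exec.outputs`). The invariant of the search is
`DomSearch.run_dfs`; the whole run is described by `DomSearch.run_main`.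
-/

/-! ### A structured language of stack programs and its compilation -/

/-- Structured programs that work on stacks indexed by `K`, all with the alphabet `Γ`. -/
inductive StackProg (K Γ : Type) : Type
  /-- Do nothing. -/
  | skip : StackProg K Γ
  /-- Push a symbol. -/
  | push (k : K) (a : Γ) : StackProg K Γ
  /-- Pop a stack and branch on the popped symbol (`none` if the stack is empty). -/
  | pop (k : K) (f : Option Γ → StackProg K Γ) : StackProg K Γ
  /-- Run one program after another. -/
  | seq (p q : StackProg K Γ) : StackProg K Γ
  /-- As long as the top symbol `a` of the stack exists and satisfies `c`, pop it and run `f a`. -/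
  | loop (k : K) (c : Γ → Bool) (f : Γ → StackProg K Γ) : StackProg K Γ

namespace StackProg

open Turing Function

variable {K Γ : Type}

/-- The program points of a program. -/
def Label : StackProg K Γ → Type
  | skip => Unit
  | push _ _ => Unit
  | pop _ f => Option (Σ o, Label (f o))
  | seq p q => Label p ⊕ Label q
  | loop _ _ f => Option (Σ a, Label (f a))

/-- The program point at which a program starts. -/
def entry : (p : StackProg K Γ) → Label p
  | skip => ()
  | push _ _ => ()
  | pop _ _ => none
  | seq p _ => Sum.inl (entry p)
  | loop _ _ _ => none

theorem finite_label [Finite Γ] (p : StackProg K Γ) : Finite (Label p) := by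
  induction p with
  | skip => exact inferInstanceAs (Finite Unit)
  | push => exact inferInstanceAs (Finite Unit)
  | pop k f ih => exact inferInstanceAs (Finite (Option (Σ o, Label (f o))))
  | seq p q ihp ihq => exact inferInstanceAs (Finite (Label p ⊕ Label q))
  | loop k c f ih => exact inferInstanceAs (Finite (Option (Σ a, Label (f a))))

/-- The stack alphabets of the compiled machine: the stacks of the program and one more stack
for the output. -/
abbrev Alph (K Γ : Type) : Option K → Type
  | none => Bool
  | some _ => Γ

/-- The statements at the program points of `p`, as part of a machine with labels `Λ`: `emb` embeds
the program points, and `exit` is the label to which `p` passes control at its end. The internal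
state of the machine is the last symbol read. -/
def stmts {Λ : Type} : (p : StackProg K Γ) → (Label p → Λ) → Λ → Label p →
    TM2.Stmt (Alph K Γ) Λ (Option Γ)
  | skip, _, exit, _ => .goto fun _ => exit
  | push k a, _, exit, _ => .push (some k) (fun _ => a) (.goto fun _ => exit)
  | pop k f, emb, exit, l =>
    match l with
    | none => .pop (some k) (fun _ o => o) (.goto fun v => emb (some ⟨v, entry (f v)⟩))
    | some ⟨o, l⟩ => stmts (f o) (fun l => emb (some ⟨o, l⟩)) exit l
  | seq p q, emb, exit, l =>
    match l with
    | .inl l => stmts p (fun l => emb (.inl l)) (emb (.inr (entry q))) l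
    | .inr l => stmts q (fun l => emb (.inr l)) exit l
  | loop k c f, emb, exit, l =>
    match l with
    | none => .peek (some k) (fun _ o => o) (.branch (fun v => v.any c)
        (.pop (some k) (fun _ o => o)
          (.goto fun v => v.elim exit fun a => emb (some ⟨a, entry (f a)⟩)))
        (.goto fun _ => exit))
    | some ⟨a, l⟩ => stmts (f a) (fun l => emb (some ⟨a, l⟩)) (emb none) l

/-- `Exec p s s' t`: started with the stacks `s`, the program `p` ends with the stacks `s'` after at
most `t` steps. -/
inductive Exec [DecidableEq K] : StackProg K Γ → (K → List Γ) → (K → List Γ) → ℕ → Prop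
  | skip {s} : Exec skip s s 1
  | push {k a s} : Exec (push k a) s (update s k (a :: s k)) 1
  | pop {k f s s' t} (h : Exec (f (s k).head?) (update s k (s k).tail) s' t) :
      Exec (pop k f) s s' (t + 1)
  | seq {p q s s' s'' t t'} (h : Exec p s s' t) (h' : Exec q s' s'' t') :
      Exec (seq p q) s s'' (t + t')
  | loop_end {k c f s} (h : (s k).head?.any c = false) : Exec (loop k c f) s s 1
  | loop_step {k c f s s' s'' a l t t'} (hk : s k = a :: l) (hc : c a = true)
      (h : Exec (f a) (update s k l) s' t) (h' : Exec (loop k c f) s' s'' t') :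
      Exec (loop k c f) s s'' (t + t' + 1)
  | mono {p s s' t t'} (h : Exec p s s' t) (ht : t ≤ t') : Exec p s s' t'

/-- The stacks of the compiled machine, with an empty output stack. -/
def lift (s : K → List Γ) : ∀ k, List (Alph K Γ k)
  | none => []
  | some k => s k

theorem update_lift [DecidableEq K] (s : K → List Γ) (k : K) (l : List Γ) :
    update (lift s) (some k) l = lift (update s k l) := by
  funext j
  cases j with
  | none => simp [lift]
  | some j =>
    by_cases h : j = k
    · subst h; simp [lift]
    · simp [lift, h]

/-- The machine `M` passes from `c` to `c'` in at most `t` steps. -/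
def MReach [DecidableEq K] {Λ : Type} (M : Λ → TM2.Stmt (Alph K Γ) Λ (Option Γ))
    (c c' : TM2.Cfg (Alph K Γ) Λ (Option Γ)) (t : ℕ) : Prop :=
  Nonempty (StateTransition.EvalsToInTime (TM2.step M) c (some c') t)

section

variable [DecidableEq K] {Λ : Type} {M : Λ → TM2.Stmt (Alph K Γ) Λ (Option Γ)}

theorem MReach.trans {a b c} {t t' : ℕ} (h : MReach M a b t) (h' : MReach M b c t') :
    MReach M a c (t + t') := by
  obtain ⟨h⟩ := h
  obtain ⟨h'⟩ := h'
  rw [add_comm]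
  exact ⟨h.trans _ _ _ _ _ _ h'⟩

theorem MReach.mono {a b} {t t' : ℕ} (h : MReach M a b t) (ht : t ≤ t') : MReach M a b t' := by
  obtain ⟨h⟩ := h
  exact ⟨⟨h.1, h.2.trans ht⟩⟩

theorem MReach.single {a b} (h : TM2.step M a = some b) : MReach M a b 1 :=
  ⟨⟨⟨1, by simpa [flip] using h⟩, le_rfl⟩⟩

/-- The compiled machine simulates the program: correctness of the compilation. -/
theorem Exec.mReach {p : StackProg K Γ} {s s' : K → List Γ} {t : ℕ} (h : Exec p s s' t)
    (emb : Label p → Λ) (exit : Λ) (hM : ∀ l, M (emb l) = stmts p emb exit l) (v : Option Γ) :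
    ∃ v', MReach M ⟨some (emb (entry p)), v, lift s⟩ ⟨some exit, v', lift s'⟩ t := by
  have e : ∀ {q : StackProg K Γ} {emb : Label q → Λ} {exit : Λ}
      (_ : ∀ l, M (emb l) = stmts q emb exit l) (l : Label q) (v : Option Γ) (s : K → List Γ),
      TM2.step M ⟨some (emb l), v, lift s⟩ =
        some (TM2.stepAux (stmts q emb exit l) v (lift s)) :=
    fun hM l v s => by rw [TM2.step, hM]
  induction h generalizing exit v with
  | skip => exact ⟨v, .single (by simp [hM, stmts])⟩
  | @push k a s => exact ⟨v, .single (by simp [hM, stmts, update_lift]; rfl)⟩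
  | @pop k f s s' t h ih =>
    obtain ⟨v', h'⟩ := ih (fun l => emb (some ⟨(s k).head?, l⟩)) exit
      (fun l => hM (some ⟨(s k).head?, l⟩)) (s k).head?
    refine ⟨v', ?_⟩
    rw [add_comm]
    refine MReach.trans (.single ((e hM none v s).trans ?_)) h'
    simp only [stmts, TM2.stepAux]
    rw [← update_lift]
    rfl
  | @seq p q s s' s'' t t' _ _ ih ih' =>
    obtain ⟨v₁, h₁⟩ := ih (fun l => emb (.inl l)) (emb (.inr (entry q)))
      (fun l => hM (.inl l)) v
    obtain ⟨v₂, h₂⟩ := ih' (fun l => emb (.inr l)) exit (fun l => hM (.inr l)) v₁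
    exact ⟨v₂, h₁.trans h₂⟩
  | @loop_end k c f s h =>
    refine ⟨(s k).head?, .single ((e hM none v s).trans ?_)⟩
    have h' : (lift s (some k)).head?.any c = false := h
    simp only [stmts, TM2.stepAux, h', cond_false]
    rfl
  | @loop_step k c f s s' s'' a l t t' hk hc _ _ ih ih' =>
    obtain ⟨v₁, h₁⟩ := ih (fun l => emb (some ⟨a, l⟩)) (emb none)
      (fun l => hM (some ⟨a, l⟩)) (some a)
    obtain ⟨v₂, h₂⟩ := ih' emb exit hM v₁
    refine ⟨v₂, ?_⟩
    rw [add_comm]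
    refine MReach.trans (.single ((e hM none v s).trans ?_)) (h₁.trans h₂)
    have hk' : lift s (some k) = a :: l := hk
    simp only [stmts, TM2.stepAux, hk', List.head?_cons, Option.any_some, hc,
      cond_true, List.tail_cons, Option.elim_some]
    rw [← update_lift]
  | mono _ ht ih =>
    obtain ⟨v', h'⟩ := ih emb exit hM v
    exact ⟨v', h'.mono ht⟩

end

/-- The machine that runs `p` on an input on the stack `i` and outputs whether the stack `o` is
then nonempty. The label `none` stands for the end of `p`. -/
noncomputable def machine [DecidableEq K] [Fintype K] [Fintype Γ] (p : StackProg K Γ) (i o : K) :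
    TM2ComputableAux Γ Bool :=
  haveI : Fintype (Label p) := @Fintype.ofFinite _ (finite_label p)
  { tm :=
      { K := Option K
        k₀ := some i
        k₁ := none
        Γ := Alph K Γ
        Λ := Option (Label p)
        main := some (entry p)
        σ := Option Γ
        initialState := none
        Γk₀Fin := inferInstanceAs (Fintype Γ)
        m := fun l => l.elim
          (.pop (some o) (fun _ v => v)
            (.push none (fun v => v.isSome) (.load (fun _ => none) .halt)))
          (stmts p some none) }
    inputAlphabet := Equiv.refl Γ
    outputAlphabet := Equiv.refl Bool }

theorem finite_machine [DecidableEq K] [Fintype K] [Fintype Γ] (p : StackProg K Γ) (i o : K)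
    (k : (machine p i o).tm.K) : Finite ((machine p i o).tm.Γ k) := by
  cases k with
  | none => exact inferInstanceAs (Finite Bool)
  | some k => exact inferInstanceAs (Finite Γ)

/-- The compiled machine answers `b` if the program ends with all stacks empty, except that the
answer stack holds a single symbol if `b` is true. -/
theorem Exec.outputs [DecidableEq K] [Fintype K] [Fintype Γ] {p : StackProg K Γ} {i o : K}
    {w : List Γ} {x : List Γ} {t : ℕ} (hx : x.length ≤ 1)
    (h : Exec p (update (fun _ => []) i w) (update (fun _ => []) o x) t) :
    Nonempty (TM2OutputsInTime (machine p i o).tm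
      (w.map (machine p i o).inputAlphabet.invFun)
      (some ([!x.isEmpty].map (machine p i o).outputAlphabet.invFun)) (t + 1)) := by
  obtain ⟨v', h'⟩ := h.mReach (M := (machine p i o).tm.m) some none (fun l => rfl) none
  have h'' : MReach (machine p i o).tm.m ⟨some none, v', lift (update (fun _ => []) o x)⟩
      (haltList (machine p i o).tm [!x.isEmpty]) 1 := by
    refine MReach.single (congrArg some ?_)
    show TM2.Cfg.mk _ _ _ = TM2.Cfg.mk _ _ _
    congr 1
    funext k
    cases k with
    | none => cases x <;> simp [lift] <;> rfl
    | some k =>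
      have : x.tail = [] := by cases x <;> simp_all
      by_cases hk : k = o
      · subst hk
        simp [lift, this]
        rfl
      · simp [lift, hk]
        rfl
  have h3 := h'.trans h''
  have e1 : initList (machine p i o).tm (w.map (machine p i o).inputAlphabet.invFun) =
      ⟨some (some (entry p)), none, lift (update (fun _ => []) i w)⟩ := by
    show TM2.Cfg.mk _ _ _ = TM2.Cfg.mk _ _ _
    congr 1
    funext k
    cases k with
    | none => rfl
    | some k =>
      by_cases hk : k = i
      · subst hk
        exact (dif_pos rfl).trans ((List.map_id w).trans
          (show update (fun _ => []) k w k = w from by simp).symm)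
      · exact (dif_neg fun h => hk (Option.some.inj h)).trans
          (update_of_ne (f := fun _ => []) hk w).symm
  unfold TM2OutputsInTime
  rw [e1]
  exact h3

end StackProg

/-! ### The stacks of the program -/

namespace DomSearch

open StackProg

/-- The stacks of the program: the input `inp`; the number of vertices `cnt`, in unary; the
adjacency matrix `mat`, and `mat2` for the rows already scanned; the current vector `vec`, and
`work` for moving it; for the search, the bits `todo` that are still to be chosen, the marks `flips`
of the chosen bits, the budget `bud` and the direction `ctl`; the tokens `q` that represent `p`, and
`q2` for those in use; the result `hit` of a scan; a flag `flag`; the answer `ans`. -/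
inductive Stk
  | inp | cnt | mat | mat2 | vec | work | todo | flips | bud | q | q2 | hit | flag | ctl | ans
  deriving DecidableEq

instance : Fintype Stk where
  elems := {.inp, .cnt, .mat, .mat2, .vec, .work, .todo, .flips, .bud, .q, .q2, .hit, .flag, .ctl,
    .ans}
  complete k := by cases k <;> decide

/-- The stack alphabet: two bits and a separator. -/
abbrev Sym := Option Bool

/-- Programs on these stacks. -/
abbrev Prg := StackProg Stk Sym

/-- The contents of all stacks, top symbols first. With named fields, in place of a
function on `Stk`, the stacks after a few instructions are found by definitional unfolding. -/
structure Mem where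
  inp : List Sym
  cnt : List Sym
  mat : List Sym
  mat2 : List Sym
  vec : List Sym
  work : List Sym
  todo : List Sym
  flips : List Sym
  bud : List Sym
  q : List Sym
  q2 : List Sym
  hit : List Sym
  flag : List Sym
  ctl : List Sym
  ans : List Sym

namespace Mem

/-- The contents of a stack. -/
def get (m : Mem) : Stk → List Sym
  | .inp => m.inp | .cnt => m.cnt | .mat => m.mat | .mat2 => m.mat2 | .vec => m.vec
  | .work => m.work | .todo => m.todo | .flips => m.flips | .bud => m.bud | .q => m.q
  | .q2 => m.q2 | .hit => m.hit | .flag => m.flag | .ctl => m.ctl | .ans => m.ans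

/-- Replace the contents of a stack. -/
def set (m : Mem) (k : Stk) (l : List Sym) : Mem :=
  match k with
  | .inp => { m with inp := l }
  | .cnt => { m with cnt := l }
  | .mat => { m with mat := l }
  | .mat2 => { m with mat2 := l }
  | .vec => { m with vec := l }
  | .work => { m with work := l }
  | .todo => { m with todo := l }
  | .flips => { m with flips := l }
  | .bud => { m with bud := l }
  | .q => { m with q := l }
  | .q2 => { m with q2 := l }
  | .hit => { m with hit := l }
  | .flag => { m with flag := l }
  | .ctl => { m with ctl := l }
  | .ans => { m with ans := l }

theorem get_injective : Function.Injective get := by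
  intro m m' h
  cases m
  cases m'
  congr 1
  exacts [congrFun h .inp, congrFun h .cnt, congrFun h .mat, congrFun h .mat2, congrFun h .vec,
    congrFun h .work, congrFun h .todo, congrFun h .flips, congrFun h .bud, congrFun h .q,
    congrFun h .q2, congrFun h .hit, congrFun h .flag, congrFun h .ctl, congrFun h .ans]

theorem get_set (m : Mem) (k : Stk) (l : List Sym) :
    (m.set k l).get = Function.update m.get k l := by
  funext j
  cases k <;> cases j <;> rfl

theorem set_get (m : Mem) (k : Stk) : m.set k (m.get k) = m :=
  get_injective (by simp [get_set])

end Mem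

/-- `Run p m m' t`: the program `p` turns the stacks `m` into `m'` within `t` steps. -/
def Run (p : Prg) (m m' : Mem) (t : ℕ) : Prop :=
  Exec p m.get m'.get t

namespace Run

variable {p q : Prg} {m m' m'' : Mem} {k : Stk} {a : Sym} {l : List Sym} {t t' : ℕ}

theorem skip : Run .skip m m 1 := Exec.skip

theorem push : Run (.push k a) m (m.set k (a :: m.get k)) 1 := by
  rw [Run, Mem.get_set]
  exact Exec.push

theorem pop {f : Option Sym → Prg} (h : Run (f (m.get k).head?) (m.set k (m.get k).tail) m' t) :
    Run (.pop k f) m m' (t + 1) := by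
  rw [Run, Mem.get_set] at h
  exact Exec.pop h

theorem pop_nil {f : Option Sym → Prg} (hk : m.get k = []) (h : Run (f none) m m' t) :
    Run (.pop k f) m m' (t + 1) := by
  refine pop ?_
  have : m.set k [] = m := hk ▸ m.set_get k
  rw [hk]
  simpa only [List.tail_nil, this, List.head?_nil] using h

theorem pop_cons {f : Option Sym → Prg} (hk : m.get k = a :: l)
    (h : Run (f (some a)) (m.set k l) m' t) : Run (.pop k f) m m' (t + 1) := by
  refine pop ?_
  rw [hk]
  exact h

theorem seq (h : Run p m m' t) (h' : Run q m' m'' t') : Run (.seq p q) m m'' (t + t') :=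
  Exec.seq h h'

theorem push_seq (h : Run p (m.set k (a :: m.get k)) m' t) :
    Run (.seq (.push k a) p) m m' (t + 1) := by
  rw [add_comm]
  exact push.seq h

theorem loop_end {c : Sym → Bool} {f : Sym → Prg} (h : (m.get k).head?.any c = false) :
    Run (.loop k c f) m m 1 :=
  Exec.loop_end h

theorem loop_step {c : Sym → Bool} {f : Sym → Prg} (hk : m.get k = a :: l) (hc : c a = true)
    (h : Run (f a) (m.set k l) m' t) (h' : Run (.loop k c f) m' m'' t') :
    Run (.loop k c f) m m'' (t + t' + 1) := by
  rw [Run, Mem.get_set] at h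
  exact Exec.loop_step hk hc h h'

theorem congr (h : Run p m m' t) (hm : m' = m'' := by rfl) (ht : t ≤ t' := by omega) :
    Run p m m'' t' :=
  hm ▸ Exec.mono h ht

end Run

/-! ### The program -/

/-- Sequential composition. -/
infixr:60 " ;; " => StackProg.seq

/-- Move the symbols of a stack, as long as they satisfy `c`, to another stack. -/
def moveWhile (c : Sym → Bool) (j k : Stk) : Prg := .loop j c (.push k)

/-- Move a stack onto another one, which reverses it. -/
def move (j k : Stk) : Prg := moveWhile (fun _ => true) j k

/-- Empty a stack. -/
def clear (k : Stk) : Prg := .loop k (fun _ => true) fun _ => .skip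

/-- Pop a symbol, if there is one, and go on with it. -/
def withTop (k : Stk) (f : Sym → Prg) : Prg := .pop k fun o => o.elim .skip f

/-- Compare a row of the matrix with the vector on `vec`, which moves to `work`; `flag` receives a
token for every common `1`. -/
def scanRow : Prg :=
  .loop .mat Option.isSome fun a => .push .mat2 a ;; withTop .vec fun d => .push .work d ;;
    if a = some true ∧ d = some true then .push .flag (some true) else .skip

/-- Record on `hit`, for every row of the matrix, whether it has a `1` in common with the vector on
`vec`. -/
def scanRows : Prg :=
  (.loop .mat (fun _ => true) fun _ => .push .mat2 none ;; scanRow ;; move .work .vec ;;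
    (.pop .flag fun o => .push .hit (some o.isSome)) ;; clear .flag) ;;
  move .mat2 .mat

/-- Go through the vector on `vec` and the stack `hit` in parallel. -/
def zipHits (act : Sym → Option Sym → Prg) : Prg :=
  move .vec .work ;; .loop .work (fun _ => true) fun d => .push .vec d ;; .pop .hit fun o => act d o

/-- Five tokens on `bud` for a vertex that the vector does not dominate: a dominating set is sought
among the sets that differ from `X` in at most `5k` vertices. -/
def budgetAct (d : Sym) (o : Option Sym) : Prg :=
  if d = some false ∧ o = some (some false) then
    .push .bud (some true) ;; .push .bud (some true) ;; .push .bud (some true) ;;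
      .push .bud (some true) ;; .push .bud (some true)
  else .skip

/-- Take a token from `q` for a vertex that is in the vector or has no neighbour in it; if `q` is
empty, raise `flag`. -/
def sizeAct (d : Sym) (o : Option Sym) : Prg :=
  if d = some true ∨ o = some (some false) then
    .pop .q fun x => x.elim (.push .flag (some true)) (.push .q2)
  else .skip

/-- Raise `ans` if the vector on `vec` can be completed to a dominating set with at most as many
elements as there are tokens on `q`. -/
def leafTest : Prg :=
  scanRows ;; zipHits sizeAct ;;
  (.pop .flag fun o => o.elim (.pop .ans fun _ => .push .ans (some true)) fun _ => .skip) ;;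
  clear .flag ;; move .q2 .q

/-- The depth-first search through all vectors that arise from `todo` by flipping at most as many
bits as there are tokens on `bud`. The stack `flips` records which bits of `vec` are flipped; a `1`
on `ctl` asks for a descent, a `0` for backtracking. A descent first keeps every bit; backtracking
over a kept bit flips it and descends again if the budget allows, and otherwise goes on up. -/
def dfs : Prg :=
  .loop .ctl (fun _ => true) fun c =>
    if c = some true then
      .pop .todo fun o => o.elim (leafTest ;; .push .ctl (some false)) fun x =>
        .push .vec x ;; .push .flips (some false) ;; .push .ctl (some true)
    else withTop .flips fun fl =>
      if fl = some true then
        withTop .vec fun x =>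
          .push .todo (x.map not) ;; .push .bud (some true) ;; .push .ctl (some false)
      else .pop .bud fun b => b.elim
        (withTop .vec fun x => .push .todo x ;; .push .ctl (some false))
        fun _ => withTop .vec fun x =>
          .push .vec (x.map not) ;; .push .flips (some true) ;; .push .ctl (some true)

/-- Split the input: the matrix goes to `mat`, the set to `vec`, and `cnt` receives a token for
every vertex. -/
def parse : Prg :=
  moveWhile (· = some true) .inp .cnt ;; .pop .inp (fun _ => .skip) ;;
  (.loop .cnt (fun _ => true) fun x => .push .work x ;; moveWhile Option.isSome .inp .mat ;;
    .pop .inp fun _ => .push .mat none) ;;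
  moveWhile Option.isSome .inp .vec ;; .pop .inp (fun _ => .skip) ;; move .work .cnt

/-- Subtract one from the binary number on `inp`, unless it is zero, in which case nothing
happens; `q` receives a token if the number was positive. The zeros below the lowest `1` turn
into ones while they are on `work`. -/
def decrement : Prg :=
  (.loop .inp (· = some false) fun _ => .push .work (some true)) ;;
  .pop .inp fun o => o.elim (.loop .work (fun _ => true) fun _ => .push .inp (some false))
    fun _ => .push .inp (some false) ;; move .work .inp ;; .push .q (some true)

/-- Compute the budget from the set on `vec`, and search. -/
def search : Prg :=
  scanRows ;; zipHits budgetAct ;; move .vec .todo ;; .push .ctl (some true) ;; dfs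

/-- The program that decides Dominating Set above `3`-independence. After `cnt` decrements of `p`,
the number on `inp` is zero if and only if `p` is at most the number of vertices; otherwise the
search is skipped, and `ans` stays empty. All other stacks are empty in the end. -/
def main : Prg :=
  parse ;; (.loop .cnt (fun _ => true) fun _ => decrement) ;;
  (.loop .inp (· = some false) fun _ => .skip) ;;
  .pop .inp (fun o => o.elim search fun _ => .skip) ;;
  clear .inp ;; clear .mat ;; clear .vec ;; clear .todo ;; clear .bud ;; clear .q

/-! ### Basic loops -/

/-- A word of bits over the stack alphabet. -/
abbrev bits (l : List Bool) : List Sym := l.map some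

/-- A number in unary. -/
abbrev un (n : ℕ) : List Sym := List.replicate n (some true)

/-- A matrix: its rows, each of them after a separator. -/
def encMat (rows : List (List Bool)) : List Sym := rows.flatMap fun r => none :: bits r

/-- Two vectors have a common `1`: for a row of the adjacency matrix and the characteristic word of
a set, the vertex has a neighbour in the set. -/
def meets (r D : List Bool) : Bool := (r.zip D).any fun x => x.1 && x.2

theorem run_moveWhile {c : Sym → Bool} {j k : Stk} (hjk : j ≠ k) (v l : List Sym)
    (hv : ∀ a ∈ v, c a = true) (hl : l.head?.any c = false) (m : Mem) (hm : m.get j = v ++ l) :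
    Run (moveWhile c j k) m ((m.set j l).set k (v.reverse ++ m.get k)) (2 * v.length + 1) := by
  induction v generalizing m with
  | nil =>
    rw [List.nil_append] at hm
    refine (Run.loop_end (by rwa [hm])).congr (Mem.get_injective ?_)
    have : Function.update m.get j l = m.get := by rw [← hm, Function.update_eq_self]
    simp [Mem.get_set, this]
  | cons a v ih =>
    refine (Run.loop_step hm (hv a (by simp)) Run.push
      (ih (fun a ha => hv a (by simp [ha])) _ ?_)).congr (Mem.get_injective ?_) ?_
    · simp [Mem.get_set, hjk]
    · simp only [Mem.get_set, Function.update_self, Function.update_of_ne hjk.symm]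
      rw [Function.update_comm hjk.symm, Function.update_idem, Function.update_idem]
      simp
    · simp; omega

theorem run_move {j k : Stk} (hjk : j ≠ k) (m : Mem) :
    Run (move j k) m ((m.set j []).set k ((m.get j).reverse ++ m.get k))
      (2 * (m.get j).length + 1) :=
  run_moveWhile hjk _ [] (by simp) rfl m (by simp)

theorem run_clear (k : Stk) (m : Mem) :
    Run (clear k) m (m.set k []) (2 * (m.get k).length + 1) := by
  generalize hl : m.get k = l
  induction l generalizing m with
  | nil =>
    refine (Run.loop_end (by simp [hl])).congr (Mem.get_injective ?_)
    simp [Mem.get_set, ← hl]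
  | cons a l ih =>
    refine (Run.loop_step hl rfl Run.skip (ih _ ?_)).congr (Mem.get_injective ?_) ?_
    · simp [Mem.get_set]
    · simp [Mem.get_set]
    · simp; omega

/-- The number `e'` of tokens on `flag` matters only as far as it is zero or not, and for the time
it takes to remove them. -/
theorem run_scanRow (r D : List Bool) (hrD : r.length = D.length) (l : List Sym)
    (hl : l.head?.any Option.isSome = false) (e : ℕ) (m : Mem) (hmat : m.mat = bits r ++ l)
    (hvec : m.vec = bits D) (hflag : m.flag = un e) :
    ∃ e', e' ≤ e + r.length ∧ (e' = 0 ↔ e = 0 ∧ meets r D = false) ∧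
    Run scanRow m { m with
      mat := l
      mat2 := (bits r).reverse ++ m.mat2
      vec := []
      work := (bits D).reverse ++ m.work
      flag := un e' } (5 * r.length + 1) := by
  induction r generalizing D m e with
  | nil =>
    obtain rfl : D = [] := by simpa using hrD.symm
    refine ⟨e, by simp, by simp [meets],
      (Run.loop_end (by simpa [Mem.get, hmat] using hl)).congr ?_⟩
    cases m
    simp_all
  | cons a r ih =>
    cases D with
    | nil => simp at hrD
    | cons d D =>
      by_cases had : a = true ∧ d = true
      · obtain ⟨rfl, rfl⟩ := had
        obtain ⟨e', h1, h2, h3⟩ := ih D (by simpa using hrD) (e + 1)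
          { m with
            mat := bits r ++ l
            mat2 := some true :: m.mat2
            vec := bits D
            work := some true :: m.work
            flag := un (e + 1) } rfl rfl rfl
        refine ⟨e', by simp; omega, by simp [h2, meets], ?_⟩
        refine Run.congr (Run.loop_step (t := 4) hmat rfl ?_ h3) ?_ ?_
        · refine Run.push_seq (Run.pop_cons hvec (Run.push_seq (Run.push.congr ?_)))
          simp [hflag, Mem.set, Mem.get, List.replicate_succ]
        · simp
        · simp; omega
      · obtain ⟨e', h1, h2, h3⟩ := ih D (by simpa using hrD) e
          { m with
            mat := bits r ++ l
            mat2 := some a :: m.mat2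
            vec := bits D
            work := some d :: m.work
            flag := un e } rfl rfl rfl
        refine ⟨e', by simp; omega, ?_, ?_⟩
        · rw [h2]
          simp only [meets, List.zip_cons_cons, List.any_cons]
          cases a <;> cases d <;> simp_all
        refine Run.congr (Run.loop_step (t := 4) hmat rfl ?_ h3) ?_ ?_
        · refine Run.push_seq (Run.pop_cons hvec (Run.push_seq ?_))
          rw [if_neg (by simpa using had)]
          exact Run.skip.congr (by simp [hflag, Mem.set, Mem.get])
        · simp
        · simp; omega

/-! ### The test of a vector -/

theorem length_encMat {n : ℕ} (rows : List (List Bool)) (hrows : ∀ r ∈ rows, r.length = n) :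
    (encMat rows).length = rows.length * (n + 1) := by
  induction rows with
  | nil => simp [encMat]
  | cons r rows ih =>
    have := ih fun r hr => hrows r (by simp [hr])
    simp only [encMat, List.flatMap_cons, List.length_append, List.length_cons, List.length_map,
      hrows r (by simp)] at this ⊢
    rw [this]
    ring

theorem run_scanRows (rows : List (List Bool)) (D : List Bool)
    (hrows : ∀ r ∈ rows, r.length = D.length) (m : Mem) (hmat : m.mat = encMat rows)
    (hvec : m.vec = bits D) (hwork : m.work = []) (hflag : m.flag = []) (hmat2 : m.mat2 = [])
    (hhit : m.hit = []) :
    Run scanRows m { m with hit := bits (rows.map (meets · D)).reverse }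
      (rows.length * (11 * D.length + 12) + 2) := by
  have key : ∀ m : Mem, m.mat = encMat rows → m.vec = bits D → m.work = [] → m.flag = [] →
      Run (.loop .mat (fun _ => true) fun _ => .push .mat2 none ;; scanRow ;; move .work .vec ;;
        (.pop .flag fun o => .push .hit (some o.isSome)) ;; clear .flag) m
      { m with
        mat := []
        mat2 := (encMat rows).reverse ++ m.mat2
        hit := bits (rows.map (meets · D)).reverse ++ m.hit }
      (rows.length * (9 * D.length + 10) + 1) := by
    clear! m
    induction rows with
    | nil =>
      intro m hmat hvec hwork hflag
      refine Run.congr (Run.loop_end (by simp [Mem.get, hmat, encMat])) ?_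
      cases m
      simp_all [encMat]
    | cons r rows ih =>
      intro m hmat hvec hwork hflag
      have hr : r.length = D.length := hrows r (by simp)
      have hl : (encMat rows).head?.any Option.isSome = false := by cases rows <;> simp [encMat]
      obtain ⟨e, he, he', h1⟩ := run_scanRow r D hr (encMat rows) hl 0
        { m with
          mat := bits r ++ encMat rows
          mat2 := none :: m.mat2 } rfl hvec hflag
      refine Run.congr (Run.loop_step (a := none) (l := bits r ++ encMat rows)
        (t := 9 * D.length + 8)
        (m' := { m with
          mat := encMat rows
          mat2 := (encMat [r]).reverse ++ m.mat2
          hit := some (meets r D) :: m.hit }) hmat rfl ?_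
        (ih (fun r hr => hrows r (by simp [hr])) _ rfl hvec hwork hflag)) ?_ ?_
      · refine Run.congr (Run.push_seq (h1.seq ((run_move (by decide) _).seq
          ((Run.pop Run.push).seq (run_clear _ _))))) ?_ ?_
        · simp only [Mem.set, Mem.get, hwork, hvec, hflag, encMat, Mem.mk.injEq]
          simp
          cases e <;> simp_all [List.replicate_succ]
        · simp [Mem.set, Mem.get, hwork]
          omega
      · simp [encMat]
      · simp
        ring_nf
        omega
  have hlen := length_encMat rows hrows
  refine Run.congr ((key m hmat hvec hwork hflag).seq (run_move (by decide) _)) ?_ ?_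
  · simp [Mem.set, Mem.get, hmat, hmat2, hhit]
  · simp only [Mem.get, hmat2, List.append_nil, List.length_reverse, hlen]
    ring_nf
    omega

/-- The number of places `i` such that the first word has a `1`, or the second word a `0`. -/
def cost (D H : List Bool) : ℕ := (D.zip H).countP fun x => x.1 || !x.2

/-- The number of places `i` such that both words have a `0`. -/
def missing (D H : List Bool) : ℕ := (D.zip H).countP fun x => !x.1 && !x.2

theorem run_zipHits_budget (D H : List Bool) (hDH : D.length = H.length) (b : ℕ) (m : Mem)
    (hvec : m.vec = bits D.reverse) (hwork : m.work = []) (hhit : m.hit = bits H)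
    (hbud : m.bud = un b) :
    Run (zipHits budgetAct) m { m with hit := [], bud := un (b + 5 * missing D H) }
      (10 * D.length + 2) := by
  have key : ∀ m : Mem, m.work = bits D → m.hit = bits H → m.bud = un b →
      Run (.loop .work (fun _ => true) fun d => .push .vec d ;; .pop .hit fun o => budgetAct d o) m
        { m with
          work := []
          vec := (bits D).reverse ++ m.vec
          hit := []
          bud := un (b + 5 * missing D H) } (8 * D.length + 1) := by
    clear hvec hwork hhit hbud m
    induction D generalizing H b with
    | nil =>
      intro m hwork hhit hbud
      obtain rfl : H = [] := by simpa using hDH.symm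
      refine Run.congr (Run.loop_end (by simp [Mem.get, hwork])) ?_
      cases m
      simp_all [missing]
    | cons d D ih =>
      intro m hwork hhit hbud
      cases H with
      | nil => simp at hDH
      | cons h H =>
        have hm : missing (d :: D) (h :: H) = missing D H + if !d && !h then 1 else 0 := by
          simp [missing, List.countP_cons]
        by_cases hdh : d = false ∧ h = false
        · obtain ⟨rfl, rfl⟩ := hdh
          refine Run.congr (Run.loop_step (t := 7) hwork rfl ?_
            (ih H (by simpa using hDH) (b + 5)
            { m with
              work := bits D
              vec := some false :: m.vec
              hit := bits H
              bud := un (b + 5) } rfl rfl rfl)) ?_ ?_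
          · refine Run.push_seq (Run.pop_cons hhit ?_)
            refine Run.push_seq (Run.push_seq (Run.push_seq (Run.push_seq (Run.push.congr ?_))))
            simp [Mem.set, Mem.get, hbud, List.replicate_succ]
          · simp [hm]
            ring
          · simp
            omega
        · refine Run.congr (Run.loop_step (t := 3) hwork rfl ?_
            (ih H (by simpa using hDH) b
            { m with
              work := bits D
              vec := some d :: m.vec
              hit := bits H
              bud := un b } rfl rfl rfl)) ?_ ?_
          · refine Run.push_seq (Run.pop_cons hhit ?_)
            rw [budgetAct, if_neg (by simpa using hdh)]
            exact Run.skip.congr (by simp [Mem.set, Mem.get, hbud])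
          · have : (!d && !h) = false := by cases d <;> cases h <;> simp_all
            simp [hm, this]
          · simp
            omega
  refine Run.congr ((run_move (by decide) _).seq (key _ ?_ hhit hbud)) ?_ ?_
  · simp [Mem.set, Mem.get, hvec, hwork]
  · simp [Mem.set, Mem.get, hvec, hwork]
  · simp [Mem.get, hvec]
    omega

theorem run_zipHits_size (D H : List Bool) (hDH : D.length = H.length) (p : ℕ) (m : Mem)
    (hvec : m.vec = bits D.reverse) (hwork : m.work = []) (hhit : m.hit = bits H)
    (hq : m.q = un p) (hq2 : m.q2 = []) (hflag : m.flag = []) :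
    Run (zipHits sizeAct) m { m with
      hit := []
      q := un (p - cost D H)
      q2 := un (min p (cost D H))
      flag := un (cost D H - p) } (10 * D.length + 2) := by
  have key : ∀ (a e p : ℕ) (m : Mem), m.work = bits D → m.hit = bits H → m.q = un p →
      m.q2 = un a → m.flag = un e →
      Run (.loop .work (fun _ => true) fun d => .push .vec d ;; .pop .hit fun o => sizeAct d o) m
        { m with
          work := []
          vec := (bits D).reverse ++ m.vec
          hit := []
          q := un (p - cost D H)
          q2 := un (a + min p (cost D H))
          flag := un (e + (cost D H - p)) } (8 * D.length + 1) := by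
    clear hvec hwork hhit hq hq2 hflag m p
    induction D generalizing H with
    | nil =>
      intro a e p m hwork hhit hq hq2 hflag
      obtain rfl : H = [] := by simpa using hDH.symm
      refine Run.congr (Run.loop_end (by simp [Mem.get, hwork])) ?_
      cases m
      simp_all [cost]
    | cons d D ih =>
      intro a e p m hwork hhit hq hq2 hflag
      cases H with
      | nil => simp at hDH
      | cons h H =>
        have hm : cost (d :: D) (h :: H) = cost D H + if d || !h then 1 else 0 := by
          simp [cost, List.countP_cons]
        by_cases hdh : d = true ∨ h = false
        · have hc : (d || !h) = true := by simpa using hdh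
          have hif : sizeAct (some d) (some (some h)) =
              .pop .q fun x => x.elim (.push .flag (some true)) (.push .q2) :=
            if_pos (by simpa using hdh)
          simp only [hc, if_true] at hm
          cases p with
          | zero =>
            refine Run.congr (Run.loop_step (t := 4) hwork rfl ?_
              (ih H (by simpa using hDH) a (e + 1) 0
              { m with
                work := bits D
                vec := some d :: m.vec
                hit := bits H
                flag := un (e + 1) } rfl rfl hq hq2 rfl)) ?_ ?_
            · refine Run.push_seq (Run.pop_cons hhit ?_)
              rw [hif]
              refine Run.pop_nil hq (Run.push.congr ?_)
              simp [Mem.set, Mem.get, hflag, List.replicate_succ]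
            · simp [hm]
              omega
            · simp
              omega
          | succ p =>
            refine Run.congr (Run.loop_step (t := 4) hwork rfl ?_
              (ih H (by simpa using hDH) (a + 1) e p
              { m with
                work := bits D
                vec := some d :: m.vec
                hit := bits H
                q := un p
                q2 := un (a + 1) } rfl rfl rfl rfl hflag)) ?_ ?_
            · refine Run.push_seq (Run.pop_cons hhit ?_)
              rw [hif]
              refine Run.pop_cons hq (Run.push.congr ?_)
              simp [Mem.set, Mem.get, hq2, List.replicate_succ]
            · simp [hm]
              omega
            · simp
              omega
        · refine Run.congr (Run.loop_step (t := 3) hwork rfl ?_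
            (ih H (by simpa using hDH) a e p
            { m with
              work := bits D
              vec := some d :: m.vec
              hit := bits H } rfl rfl hq hq2 hflag)) ?_ ?_
          · refine Run.push_seq (Run.pop_cons hhit ?_)
            rw [sizeAct, if_neg (by simpa using hdh)]
            exact Run.skip.congr (by simp [Mem.set, Mem.get])
          · have : (d || !h) = false := by cases d <;> cases h <;> simp_all
            simp [hm, this]
          · simp
            omega
  refine Run.congr ((run_move (by decide) _).seq (key 0 0 p _ ?_ hhit hq hq2 hflag)) ?_ ?_
  · simp [Mem.set, Mem.get, hvec, hwork]
  · simp [Mem.set, Mem.get, hvec, hwork]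
  · simp [Mem.get, hvec]
    omega

/-- The number of elements of the vector `D` and of vertices without neighbour in `D`, where `rows`
is the adjacency matrix. -/
def totalCost (rows : List (List Bool)) (D : List Bool) : ℕ :=
  cost D.reverse (rows.map (meets · D)).reverse

/-- The content of the answer stack. -/
def ansList (b : Bool) : List Sym := if b then [some true] else []

theorem run_leafTest (rows : List (List Bool)) (D : List Bool)
    (hrows : ∀ r ∈ rows, r.length = D.length) (hD : rows.length = D.length) (p : ℕ) (b : Bool)
    (m : Mem) (hmat : m.mat = encMat rows) (hvec : m.vec = bits D) (hwork : m.work = [])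
    (hflag : m.flag = []) (hmat2 : m.mat2 = []) (hhit : m.hit = []) (hq : m.q = un p)
    (hq2 : m.q2 = []) (hans : m.ans = ansList b) :
    Run leafTest m { m with ans := ansList (b || decide (totalCost rows D ≤ p)) }
      (11 * D.length ^ 2 + 26 * D.length + 9) := by
  have hfold : cost D.reverse (rows.map (meets · D)).reverse = totalCost rows D := rfl
  have hle : totalCost rows D ≤ D.length := by
    refine List.countP_le_length.trans ?_
    simp
  refine Run.congr ((run_scanRows rows D hrows m hmat hvec hwork hflag hmat2 hhit).seq
    ((run_zipHits_size D.reverse (rows.map (meets · D)).reverse (by simp [hD]) p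
    { m with hit := bits (rows.map (meets · D)).reverse } (by simpa using hvec) hwork rfl hq hq2
      hflag).seq ((Run.seq (t := 3) (m' := { m with
      q := un (p - totalCost rows D)
      q2 := un (min p (totalCost rows D))
      flag := un (totalCost rows D - p - 1)
      ans := ansList (b || decide (totalCost rows D ≤ p)) }) ?_
      ((run_clear .flag _).seq (run_move (j := .q2) (k := .q) (by decide) _)))))) ?_ ?_
  · by_cases hc : totalCost rows D ≤ p
    · have h0 : totalCost rows D - p = 0 := by omega
      refine Run.pop_nil (by simp [Mem.get, h0, hfold]) ?_
      refine Run.pop (Run.push.congr ?_)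
      cases b <;> simp [Mem.set, Mem.get, hhit, hans, ansList, hc, hfold, h0]
    · obtain ⟨c, h0⟩ : ∃ c, totalCost rows D - p = c + 1 := ⟨totalCost rows D - p - 1, by omega⟩
      refine Run.pop_cons (a := some true) (l := un c)
        (by simp [Mem.get, h0, hfold, List.replicate_succ]) ?_
      refine Run.skip.congr ?_
      simp [Mem.set, hhit, hans, ansList, hc, hfold, h0]
  · simp [Mem.set, Mem.get, hflag, hq2, hq, List.replicate_append_replicate]
    omega
  · simp [Mem.set, Mem.get, hD]
    ring_nf
    omega

/-! ### The depth-first search -/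

theorem Run.ite_pos {c : Prop} [Decidable c] {p q : Prg} {m m' : Mem} {t : ℕ} (hc : c)
    (h : Run p m m' t) : Run (if c then p else q) m m' t := by
  rwa [if_pos hc]

theorem Run.ite_neg {c : Prop} [Decidable c] {p q : Prg} {m m' : Mem} {t : ℕ} (hc : ¬c)
    (h : Run q m m' t) : Run (if c then p else q) m m' t := by
  rwa [if_neg hc]

theorem Run.withTop_cons {k : Stk} {f : Sym → Prg} {a : Sym} {l : List Sym} {m m' : Mem} {t : ℕ}
    (hk : m.get k = a :: l) (h : Run (f a) (m.set k l) m' t) : Run (withTop k f) m m' (t + 1) :=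
  Run.pop_cons hk h

/-- Whether a vector that arises from the second word by flipping at most `b` bits, put in reverse
in front of the first word, passes the test. The recursion is that of the program. -/
def anyFlip (test : List Bool → Bool) : List Bool → List Bool → ℕ → Bool
  | d, [], _ => test d
  | d, x :: r, 0 => anyFlip test (x :: d) r 0
  | d, x :: r, b + 1 => anyFlip test (x :: d) r (b + 1) || anyFlip test ((!x) :: d) r b

theorem anyFlip_iff (test : List Bool → Bool) (d r : List Bool) (b : ℕ) :
    anyFlip test d r b = true ↔ ∃ r' : List Bool, r'.length = r.length ∧
      (r.zip r').countP (fun x => x.1 != x.2) ≤ b ∧ test (r'.reverse ++ d) = true := by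
  induction r generalizing d b with
  | nil =>
    simp only [anyFlip, List.length_nil, List.length_eq_zero_iff, List.zip_nil_left,
      List.countP_nil, zero_le, true_and, exists_eq_left, List.reverse_nil, List.nil_append]
  | cons x r ih =>
    have key : (∃ r' : List Bool, r'.length = (x :: r).length ∧
        ((x :: r).zip r').countP (fun x => x.1 != x.2) ≤ b ∧ test (r'.reverse ++ d) = true) ↔
        (∃ r' : List Bool, r'.length = r.length ∧
          (r.zip r').countP (fun x => x.1 != x.2) ≤ b ∧ test (r'.reverse ++ x :: d) = true) ∨
        (∃ r' : List Bool, r'.length = r.length ∧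
          (r.zip r').countP (fun x => x.1 != x.2) + 1 ≤ b ∧
            test (r'.reverse ++ (!x) :: d) = true) := by
      constructor
      · rintro ⟨_ | ⟨y, r'⟩, h1, h2, h3⟩
        · simp at h1
        · simp only [List.zip_cons_cons, List.countP_cons, List.reverse_cons, List.append_assoc,
            List.singleton_append, List.length_cons, add_left_inj] at h1 h2 h3
          rcases eq_or_ne y x with rfl | hxy
          · exact .inl ⟨r', h1, by simpa using h2, h3⟩
          · obtain rfl : y = !x := by cases x <;> cases y <;> simp_all
            exact .inr ⟨r', h1, by simpa using h2, h3⟩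
      · rintro (⟨r', h1, h2, h3⟩ | ⟨r', h1, h2, h3⟩)
        · exact ⟨x :: r', by simpa using h1, by simpa using h2, by simpa using h3⟩
        · exact ⟨(!x) :: r', by simpa using h1, by simpa [List.countP_cons] using h2,
            by simpa using h3⟩
    rw [key]
    cases b with
    | zero => simp [anyFlip, ih]
    | succ b => simp [anyFlip, ih]

/-- A bound for the time of a test, where `n` is the number of vertices. -/
def testTime (n : ℕ) : ℕ := 11 * n ^ 2 + 26 * n + 12

/-- A bound for the time of the search through all vectors that arise from a word of length `r` by
flipping at most `b` bits. -/
def dfsTime (n r b : ℕ) : ℕ := (testTime n + 24 * r) * (r + 1) ^ b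

theorem dfsTime_zero (n r : ℕ) : dfsTime n r 0 + 11 ≤ dfsTime n (r + 1) 0 := by
  simp [dfsTime]
  omega

theorem dfsTime_succ (n r b : ℕ) :
    dfsTime n r (b + 1) + dfsTime n r b + 24 ≤ dfsTime n (r + 1) (b + 1) := by
  have h1 : (r + 1) ^ (b + 1) + (r + 1) ^ b ≤ (r + 1 + 1) ^ (b + 1) := by
    have : (r + 1) ^ b ≤ (r + 1 + 1) ^ b := Nat.pow_le_pow_left (by omega) b
    calc (r + 1) ^ (b + 1) + (r + 1) ^ b = (r + 1) ^ b * (r + 1 + 1) := by ring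
      _ ≤ (r + 1 + 1) ^ b * (r + 1 + 1) := Nat.mul_le_mul_right _ this
      _ = _ := by ring
  have h2 : 1 ≤ (r + 1 + 1) ^ (b + 1) := Nat.one_le_pow _ _ (by omega)
  unfold dfsTime
  calc (testTime n + 24 * r) * (r + 1) ^ (b + 1) + (testTime n + 24 * r) * (r + 1) ^ b + 24
      = (testTime n + 24 * r) * ((r + 1) ^ (b + 1) + (r + 1) ^ b) + 24 * 1 := by ring
    _ ≤ (testTime n + 24 * r) * (r + 1 + 1) ^ (b + 1) + 24 * (r + 1 + 1) ^ (b + 1) :=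
      add_le_add (Nat.mul_le_mul_left _ h1) (Nat.mul_le_mul_left _ h2)
    _ = _ := by ring

/-- The depth-first search below a node, stated with the rest of the run as a hypothesis: from the
descent into the node, the program gets to backtracking from the node, after testing all leaves
below. -/
theorem run_dfs (rows : List (List Bool)) (hrows : ∀ r ∈ rows, r.length = rows.length) (p : ℕ)
    (r d : List Bool) (hlen : d.length + r.length = rows.length) (b : ℕ) (ans : Bool)
    (m m' : Mem) (t : ℕ) (hmat : m.mat = encMat rows)
    (hwork : m.work = []) (hflag : m.flag = []) (hmat2 : m.mat2 = []) (hhit : m.hit = [])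
    (hq : m.q = un p) (hq2 : m.q2 = []) (hans : m.ans = ansList ans) (hvec : m.vec = bits d)
    (htodo : m.todo = bits r) (hbud : m.bud = un b) (hctl : m.ctl = [some true])
    (h : Run dfs { m with
      ctl := [some false]
      ans := ansList (ans || anyFlip (fun D => decide (totalCost rows D ≤ p)) d r b) } m' t) :
    Run dfs m m' (dfsTime rows.length r.length b + t) := by
  induction r generalizing d b ans m m' t with
  | nil =>
    have hd : d.length = rows.length := by simpa using hlen
    refine Run.congr (Run.loop_step (t := testTime rows.length - 1) hctl rfl ?_ h) rfl ?_
    · refine Run.ite_pos rfl (Run.congr (Run.pop_nil htodo (Run.seq (run_leafTest rows d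
        (by simpa [hd] using hrows) hd.symm p ans { m with ctl := [] } hmat hvec hwork hflag hmat2
          hhit hq hq2 hans) Run.push)) ?_ ?_)
      · simp [Mem.set, Mem.get, anyFlip]
      · simp [testTime, hd]
    · have : 1 ≤ testTime rows.length := by simp [testTime]
      simp [dfsTime]
      omega
  | cons x r ih =>
    -- Keep the bit `x` and search below; on the way back, flip `x` if the budget is positive,
    -- search below once more, and restore `x` and the budget.
    cases b with
    | zero =>
      refine Run.congr (Run.loop_step (t := 4) (m' := { m with
        ctl := [some true]
        todo := bits r
        vec := bits (x :: d)
        flips := some false :: m.flips }) hctl rfl ?_ (ih (x :: d) (by simp at hlen ⊢; omega) 0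
          ans _ _ _ hmat hwork hflag hmat2 hhit hq hq2 hans rfl rfl hbud rfl
          (Run.loop_step (t := 5) (a := some false) (l := []) rfl rfl ?_ h))) rfl ?_
      · refine Run.ite_pos rfl (Run.pop_cons htodo
          (Run.push_seq (Run.push_seq (Run.push.congr ?_))))
        simp [Mem.set, Mem.get, hvec]
      · refine Run.ite_neg (by simp) (Run.withTop_cons (a := some false) (l := m.flips) rfl
          (Run.ite_neg (by simp) (Run.pop_nil hbud (Run.withTop_cons (a := some x) (l := bits d) rfl
          (Run.push_seq (Run.push.congr ?_))))))
        simp [Mem.set, Mem.get, hvec, htodo, anyFlip]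
      · have := dfsTime_zero rows.length r.length
        simp
        omega
    | succ b =>
      refine Run.congr (Run.loop_step (t := 4) (m' := { m with
        ctl := [some true]
        todo := bits r
        vec := bits (x :: d)
        flips := some false :: m.flips }) hctl rfl ?_ (ih (x :: d) (by simp at hlen ⊢; omega)
          (b + 1) ans _ _ _ hmat hwork hflag hmat2 hhit hq hq2 hans rfl rfl hbud rfl
          (Run.loop_step (t := 6) (m' := { m with
            ctl := [some true]
            todo := bits r
            vec := bits ((!x) :: d)
            bud := un b
            flips := some true :: m.flips
            ans := ansList (ans || anyFlip (fun D => decide (totalCost rows D ≤ p)) (x :: d) r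
              (b + 1)) }) (a := some false) (l := []) rfl rfl ?_
            (ih ((!x) :: d) (by simp at hlen ⊢; omega) b _ _ _ _ hmat hwork hflag hmat2 hhit hq hq2
              rfl rfl rfl rfl rfl
              (Run.loop_step (t := 5) (a := some false) (l := []) rfl rfl ?_ h)))))
        rfl ?_
      · refine Run.ite_pos rfl (Run.pop_cons htodo
          (Run.push_seq (Run.push_seq (Run.push.congr ?_))))
        simp [Mem.set, Mem.get, hvec]
      · refine Run.ite_neg (by simp) (Run.withTop_cons (a := some false) (l := m.flips) rfl
          (Run.ite_neg (by simp) (Run.pop_cons (a := some true) (l := un b) hbud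
          (Run.withTop_cons (a := some x) (l := bits d) rfl
          (Run.push_seq (Run.push_seq (Run.push.congr ?_)))))))
        simp [Mem.set, Mem.get]
      · refine Run.ite_neg (by simp) (Run.withTop_cons (a := some true) (l := m.flips) rfl
          (Run.ite_pos rfl (Run.withTop_cons (a := some !x) (l := bits d) rfl
          (Run.push_seq (Run.push_seq (Run.push.congr ?_))))))
        simp [Mem.set, Mem.get, hvec, htodo, anyFlip, hbud, List.replicate_succ, Bool.or_assoc]
      · have := dfsTime_succ rows.length r.length b
        simp
        omega

theorem run_search (rows : List (List Bool)) (hrows : ∀ r ∈ rows, r.length = rows.length) (p : ℕ)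
    (D : List Bool) (hD : D.length = rows.length) (m : Mem) (hmat : m.mat = encMat rows)
    (hwork : m.work = []) (hflag : m.flag = []) (hmat2 : m.mat2 = []) (hhit : m.hit = [])
    (hq : m.q = un p) (hq2 : m.q2 = []) (hans : m.ans = []) (hvec : m.vec = bits D.reverse)
    (htodo : m.todo = []) (hflips : m.flips = []) (hbud : m.bud = []) (hctl : m.ctl = []) :
    Run search m { m with
      vec := []
      todo := bits D
      bud := un (5 * missing D (rows.map (meets · D.reverse)).reverse)
      ans := ansList (anyFlip (fun D => decide (totalCost rows D ≤ p)) [] D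
        (5 * missing D (rows.map (meets · D.reverse)).reverse)) }
      (dfsTime rows.length rows.length (5 * missing D (rows.map (meets · D.reverse)).reverse) +
        testTime rows.length) := by
  set b := 5 * missing D (rows.map (meets · D.reverse)).reverse with hb
  refine Run.congr ((run_scanRows rows D.reverse (by simpa [hD] using hrows) m hmat hvec hwork hflag
    hmat2 hhit).seq ((run_zipHits_budget D (rows.map (meets · D.reverse)).reverse (by simp [hD]) 0
    { m with hit := bits (rows.map (meets · D.reverse)).reverse } hvec hwork rfl hbud).seq
    ((run_move (j := .vec) (k := .todo) (by decide) _).seq (Run.push_seq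
    (run_dfs rows hrows p D [] (by simpa using hD) b false _ _ _ hmat hwork hflag hmat2 rfl hq hq2
      hans rfl ?_ ?_ ?_ (Run.loop_step (t := 2) (a := some false) (l := []) rfl rfl
      (Run.ite_neg (by simp) (Run.pop_nil hflips Run.skip)) (Run.loop_end rfl)))))))
    ?_ ?_
  · simp [Mem.set, Mem.get, hvec, htodo]
  · simp [Mem.set, Mem.get, hb]
  · simp [Mem.set, Mem.get, hctl]
  · simp [Mem.set, Mem.get, hvec, htodo, hhit, hb, hctl]
  · simp [Mem.get, hvec, hD, testTime]
    ring_nf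
    omega

/-! ### The input -/

/-- The number with the given binary digits, least significant digit first. -/
def binVal (l : List Bool) : ℕ := Nat.ofDigits 2 (l.map Bool.toNat)

@[simp] theorem binVal_nil : binVal [] = 0 := rfl

@[simp] theorem binVal_cons (b : Bool) (l : List Bool) :
    binVal (b :: l) = b.toNat + 2 * binVal l := by
  simp [binVal, Nat.ofDigits_cons]

theorem binVal_replicate_false (z : ℕ) (l : List Bool) :
    binVal (List.replicate z false ++ l) = 2 ^ z * binVal l := by
  induction z with
  | zero => simp
  | succ z ih =>
    simp [List.replicate_succ, ih]
    ring

theorem binVal_replicate_true (z : ℕ) (l : List Bool) :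
    binVal (List.replicate z true ++ false :: l) + 1 = 2 ^ z * (2 * binVal l + 1) := by
  induction z with
  | zero => simp
  | succ z ih =>
    rw [pow_succ', mul_assoc, ← ih]
    simp [List.replicate_succ]
    ring

theorem binVal_encodeNat (p : ℕ) : binVal (Computability.encodeNat p) = p := by
  have key : ∀ a : PosNum, binVal (Computability.encodePosNum a) = (a : ℕ) := by
    intro a
    induction a with
    | one => simp [Computability.encodePosNum]
    | bit0 a ih => simp [Computability.encodePosNum, ih]; ring
    | bit1 a ih => simp [Computability.encodePosNum, ih]; ring
  have key' : ∀ a : Num, binVal (Computability.encodeNum a) = (a : ℕ)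
    | .zero => rfl
    | .pos a => key a
  rw [Computability.encodeNat, key', Num.to_of_nat]

theorem length_encodeNat_le (p : ℕ) : (Computability.encodeNat p).length ≤ p := by
  have key : ∀ a : PosNum, (Computability.encodePosNum a).length ≤ (a : ℕ) := by
    intro a
    induction a with
    | one => simp [Computability.encodePosNum]
    | bit0 a ih =>
      have := PosNum.to_nat_pos a
      simp [Computability.encodePosNum]
      omega
    | bit1 a ih => simp [Computability.encodePosNum]; omega
  have key' : ∀ a : Num, (Computability.encodeNum a).length ≤ (a : ℕ)
    | .zero => le_rfl
    | .pos a => key a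
  exact (key' p).trans (Num.to_of_nat p).le

/-- A binary word consists of zeros only, or it has a first `1`. -/
theorem exists_eq_replicate (l : List Bool) : (∃ z, l = List.replicate z false) ∨
    ∃ z l', l = List.replicate z false ++ true :: l' := by
  induction l with
  | nil => exact .inl ⟨0, rfl⟩
  | cons b l ih =>
    cases b with
    | true => exact .inr ⟨0, l, rfl⟩
    | false =>
      rcases ih with ⟨z, rfl⟩ | ⟨z, l', rfl⟩
      · exact .inl ⟨z + 1, rfl⟩
      · exact .inr ⟨z + 1, l', rfl⟩

theorem run_zeros (z : ℕ) (l : List Sym) (hl : l.head?.any (· = some false) = false) (m : Mem)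
    (hm : m.inp = bits (List.replicate z false) ++ l) :
    Run (.loop .inp (· = some false) fun _ => .push .work (some true)) m
      { m with
        inp := l
        work := un z ++ m.work } (2 * z + 1) := by
  induction z generalizing m with
  | zero =>
    simp only [List.replicate_zero, List.map_nil, List.nil_append] at hm
    refine Run.congr (Run.loop_end (by rwa [Mem.get, hm])) ?_
    simp [← hm]
  | succ z ih =>
    refine Run.congr (Run.loop_step (k := .inp) hm (by simp) Run.push (ih _ rfl)) ?_
    simp [List.replicate_succ', Mem.set, Mem.get]

theorem run_unzeros (z : ℕ) (m : Mem) (hm : m.work = un z) :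
    Run (.loop .work (fun _ => true) fun _ => .push .inp (some false)) m
      { m with
        inp := bits (List.replicate z false) ++ m.inp
        work := [] } (2 * z + 1) := by
  induction z generalizing m with
  | zero =>
    refine (Run.loop_end (by simp [Mem.get, hm])).congr ?_
    cases m
    simp_all
  | succ z ih =>
    refine Run.congr (Run.loop_step (k := .work) hm rfl Run.push (ih _ rfl)) ?_
    simp [List.replicate_succ', Mem.set, Mem.get]

theorem run_decrement (l : List Bool) (m : Mem) (hm : m.inp = bits l) (hwork : m.work = []) :
    ∃ l' : List Bool, l'.length = l.length ∧ binVal l' = binVal l - 1 ∧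
      Run decrement m { m with
        inp := bits l'
        q := un (min 1 (binVal l)) ++ m.q } (4 * l.length + 5) := by
  rcases exists_eq_replicate l with ⟨z, rfl⟩ | ⟨z, l, rfl⟩
  · have h0 : binVal (List.replicate z false) = 0 := by simpa using binVal_replicate_false z []
    refine ⟨_, rfl, by simp [h0], ?_⟩
    refine Run.congr ((run_zeros z [] rfl m (by simpa using hm)).seq (Run.pop_nil rfl
      (run_unzeros z _ (by simp [hwork])))) ?_ ?_
    · simp [h0, hwork]
    · simp
      omega
  · have h1 := binVal_replicate_true z l
    have h0 : binVal (List.replicate z false ++ true :: l) =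
        binVal (List.replicate z true ++ false :: l) + 1 := by
      rw [h1, binVal_replicate_false]
      simp
      ring
    refine ⟨List.replicate z true ++ false :: l, by simp, by simp [h0], ?_⟩
    refine Run.congr ((run_zeros z (some true :: bits l) (by simp) m (by simpa using hm)).seq
      (Run.pop_cons rfl (Run.push_seq ((run_move (j := .work) (k := .inp) (by decide) _).seq
        Run.push)))) ?_ ?_
    · simp [Mem.set, Mem.get, hwork, h0]
    · simp [Mem.set, Mem.get, hwork]
      omega

theorem run_decrements (n : ℕ) (l : List Bool) (m : Mem) (hm : m.inp = bits l) (hwork : m.work = [])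
    (hcnt : m.cnt = un n) (a : ℕ) (hq : m.q = un a) :
    ∃ l' : List Bool, l'.length = l.length ∧ binVal l' = binVal l - n ∧
      Run (.loop .cnt (fun _ => true) fun _ => decrement) m { m with
        inp := bits l'
        cnt := []
        q := un (a + min n (binVal l)) } (n * (4 * l.length + 6) + 1) := by
  induction n generalizing l m a with
  | zero =>
    refine ⟨l, rfl, rfl, Run.congr (Run.loop_end (by simp [Mem.get, hcnt])) ?_⟩
    cases m
    simp_all
  | succ n ih =>
    obtain ⟨l₁, h1, h2, h3⟩ := run_decrement l { m with cnt := un n } hm hwork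
    obtain ⟨l₂, h4, h5, h6⟩ := ih l₁
      { m with
        inp := bits l₁
        cnt := un n
        q := un (a + min 1 (binVal l)) } rfl hwork rfl _ rfl
    refine ⟨l₂, h4.trans h1, by omega, ?_⟩
    refine Run.congr (Run.loop_step (k := .cnt) hcnt rfl (h3.congr ?_ le_rfl) h6) ?_ ?_
    · simp [hq, add_comm]
    · simp
      omega
    · rw [h1]
      ring_nf
      omega

theorem run_dropZeros (z : ℕ) (l : List Sym) (hl : l.head?.any (· = some false) = false) (m : Mem)
    (hm : m.inp = bits (List.replicate z false) ++ l) :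
    Run (.loop .inp (· = some false) fun _ => .skip) m { m with inp := l } (2 * z + 1) := by
  induction z generalizing m with
  | zero =>
    simp only [List.replicate_zero, List.map_nil, List.nil_append] at hm
    refine Run.congr (Run.loop_end (by rwa [Mem.get, hm])) ?_
    simp [← hm]
  | succ z ih =>
    exact Run.congr (Run.loop_step (k := .inp) hm (by simp) Run.skip (ih _ rfl))

theorem isSome_of_mem_bits (v : List Bool) : ∀ a ∈ bits v, a.isSome = true := by
  intro a ha
  obtain ⟨b, -, rfl⟩ := List.mem_map.1 ha
  rfl

/-- The matrix with all rows and the order of the rows reversed, as it is after it has been moved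
from one stack to another. -/
def flipMat (rows : List (List Bool)) : List (List Bool) := (rows.map List.reverse).reverse

/-- The stacks, all empty. -/
def Mem.empty : Mem := ⟨[], [], [], [], [], [], [], [], [], [], [], [], [], [], []⟩

theorem run_parse (rows : List (List Bool)) (n : ℕ) (hrows : ∀ r ∈ rows, r.length = n)
    (hn : rows.length = n) (x : List Bool) (hx : x.length = n) (l : List Bool) :
    Run parse { Mem.empty with inp := un n ++ none :: ((rows.flatMap fun r => bits r ++ [none]) ++
      (bits x ++ none :: bits l)) }
      { Mem.empty with
        inp := bits l
        cnt := un n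
        mat := encMat (flipMat rows)
        vec := bits x.reverse } (2 * n ^ 2 + 11 * n + 8) := by
  -- The rows read so far are `acc` on `mat`, and the remaining rows arrive there in reverse.
  have key : ∀ (rest : List Sym) (acc : List (List Bool)) (w : ℕ) (m : Mem),
      m.inp = (rows.flatMap fun r => bits r ++ [none]) ++ rest → m.cnt = un rows.length →
      m.mat = encMat acc → m.work = un w →
      Run (.loop .cnt (fun _ => true) fun x => .push .work x ;; moveWhile Option.isSome .inp .mat ;;
        .pop .inp fun _ => .push .mat none) m
        { m with
          inp := rest
          cnt := []
          mat := encMat (flipMat rows ++ acc)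
          work := un (w + rows.length) } (rows.length * (2 * n + 5) + 1) := by
    clear hn
    intro rest
    induction rows with
    | nil =>
      intro acc w m hinp hcnt hmat hwork
      refine Run.congr (Run.loop_end (by simp [Mem.get, hcnt])) ?_
      cases m
      simp_all [flipMat]
    | cons r rows ih =>
      intro acc w m hinp hcnt hmat hwork
      have hr : r.length = n := hrows r (by simp)
      refine Run.congr (Run.loop_step (k := .cnt) (t := 2 * n + 4) hcnt rfl (Run.push_seq (Run.congr
        ((run_moveWhile (j := .inp) (k := .mat) (by decide) (bits r)
          (none :: ((rows.flatMap fun r => bits r ++ [none]) ++ rest)) (isSome_of_mem_bits r) rfl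
          _ ?_).seq (Run.pop_cons rfl Run.push)) ?_ ?_))
        (ih (fun r hr => hrows r (by simp [hr])) (r.reverse :: acc) (w + 1)
        { m with
          inp := (rows.flatMap fun r => bits r ++ [none]) ++ rest
          cnt := un rows.length
          mat := encMat (r.reverse :: acc)
          work := un (w + 1) } rfl rfl rfl rfl)) ?_ ?_
      · simp [Mem.set, Mem.get, hinp]
      · simp [Mem.set, Mem.get, hmat, hwork, encMat, List.replicate_succ]
      · simp [hr]
      · simp [flipMat]
        omega
      · simp
        ring_nf
        omega
  refine Run.congr ((run_moveWhile (j := .inp) (k := .cnt) (by decide) (un n) _ (by simp) ?_ _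
    rfl).seq (Run.seq (t := 2) (Run.pop_cons rfl Run.skip) ((key _ [] 0 _ rfl ?_ rfl rfl).seq
    ((run_moveWhile (j := .inp) (k := .vec) (by decide) (bits x) (none :: bits l)
      (isSome_of_mem_bits x) rfl
    _ rfl).seq (Run.seq (t := 2) (Run.pop_cons rfl Run.skip) (run_move (j := .work) (k := .cnt)
    (by decide) _)))))) ?_ ?_
  · simp
  · simp [Mem.set, Mem.get, Mem.empty, hn]
  · simp [Mem.set, Mem.get, Mem.empty, hn]
  · simp [Mem.set, Mem.get, Mem.empty, hn, hx]
    ring_nf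
    omega

/-! ### The whole program -/

/-- A bound for the running time of the program on graphs with `n` vertices, where `L` is the number
of binary digits of `p` and `b` the budget. -/
def mainTime (n L b : ℕ) : ℕ :=
  dfsTime n n b + (4 * n * L + 15 * n ^ 2 + 80 * n + 4 * L + 40)

/-- The program answers whether `p ≤ n` and a vector near the characteristic vector of `X` has cost
at most `p`. -/
theorem run_main (rows : List (List Bool)) (n : ℕ) (hrows : ∀ r ∈ rows, r.length = n)
    (hn : rows.length = n) (x : List Bool) (hx : x.length = n) (l : List Bool) :
    Run main { Mem.empty with inp := un n ++ none :: ((rows.flatMap fun r => bits r ++ [none]) ++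
      (bits x ++ none :: bits l)) }
      { Mem.empty with
        ans := ansList (decide (binVal l ≤ n) && anyFlip
          (fun D => decide (totalCost (flipMat rows) D ≤ binVal l)) [] x
          (5 * missing x ((flipMat rows).map (meets · x.reverse)).reverse)) }
      (mainTime n l.length (5 * missing x ((flipMat rows).map (meets · x.reverse)).reverse)) := by
  set b := 5 * missing x ((flipMat rows).map (meets · x.reverse)).reverse with hb
  have hbn : b ≤ 5 * n := by
    have : missing x ((flipMat rows).map (meets · x.reverse)).reverse ≤ n := by
      refine List.countP_le_length.trans ?_
      simp [hx]
    omega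
  have hflip : ∀ r ∈ flipMat rows, r.length = n := by
    simp only [flipMat, List.mem_reverse, List.mem_map]
    rintro _ ⟨r, hr, rfl⟩
    rw [List.length_reverse, hrows r hr]
  have hflip' : (flipMat rows).length = n := by simp [flipMat, hn]
  have hlen : (encMat (flipMat rows)).length = n * (n + 1) := by
    rw [length_encMat _ hflip, hflip']
  have hparse := run_parse rows n hrows hn x hx l
  obtain ⟨l', h1, h2, h3⟩ := run_decrements n l
    { Mem.empty with
      inp := bits l
      cnt := un n
      mat := encMat (flipMat rows)
      vec := bits x.reverse } rfl rfl rfl 0 rfl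
  rcases exists_eq_replicate l' with ⟨z, rfl⟩ | ⟨z, l', rfl⟩
  · have h0 : binVal (List.replicate z false) = 0 := by simpa using binVal_replicate_false z []
    have hle : binVal l ≤ n := by omega
    have hmin : min n (binVal l) = binVal l := by omega
    refine Run.congr (hparse.seq (h3.seq ((run_dropZeros z [] rfl _ (by simp)).seq ((Run.pop_nil rfl
      (run_search (flipMat rows) (by rwa [hflip']) (binVal l) x (by rw [hflip', hx]) _ rfl rfl rfl
        rfl rfl (by simp [hmin]) rfl rfl rfl rfl rfl rfl rfl)).seq ((run_clear _ _).seq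
        ((run_clear _ _).seq ((run_clear _ _).seq ((run_clear _ _).seq ((run_clear _ _).seq
        (run_clear _ _)))))))))) ?_ ?_
    · simp [Mem.set, Mem.empty, hle, hb]
    · simp [Mem.set, Mem.get, Mem.empty, ← hb, hflip', hlen, hx, mainTime, testTime, hmin] at h1 ⊢
      ring_nf
      nlinarith
  · have h0 : binVal (List.replicate z false ++ true :: l') ≠ 0 := by
      rw [binVal_replicate_false]
      simp
    have hle : ¬ binVal l ≤ n := by omega
    have hmin : min n (binVal l) = n := by omega
    refine Run.congr (hparse.seq (h3.seq ((run_dropZeros z (some true :: bits l') (by simp) _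
      (by simp)).seq ((Run.pop_cons rfl Run.skip).seq ((run_clear _ _).seq
        ((run_clear _ _).seq ((run_clear _ _).seq ((run_clear _ _).seq ((run_clear _ _).seq
        (run_clear _ _)))))))))) ?_ ?_
    · simp [Mem.set, Mem.empty, hle, ansList]
    · simp [Mem.set, Mem.get, Mem.empty, hlen, hx, mainTime, hmin] at h1 ⊢
      ring_nf
      nlinarith

end DomSearch

/-! ### Dominating sets close to a `3`-independent set -/

namespace SimpleGraph

variable {V : Type*} {G : SimpleGraph V} {X : Finset V}

/-- Closed neighbourhoods of distinct vertices of a `3`-independent set are disjoint, and no edge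
joins them. -/
theorem IsRIndependent.eq_of_touch (hX : G.IsRIndependent 3 X) {x y a b : V} (hx : x ∈ X)
    (hy : y ∈ X) (ha : a = x ∨ G.Adj x a) (hb : b = y ∨ G.Adj y b) (hab : a = b ∨ G.Adj a b) :
    x = y := by
  have key : ∀ {u v : V}, u = v ∨ G.Adj u v → G.edist u v ≤ 1 := by
    rintro u v (rfl | h)
    · simp
    · exact (edist_eq_one_iff_adj.2 h).le
  by_contra hxy
  have h1 : G.edist x y ≤ 1 + 1 + 1 :=
    (SimpleGraph.edist_triangle (v := b)).trans (add_le_add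
      ((SimpleGraph.edist_triangle (v := a)).trans
      (add_le_add (key (ha.imp_left Eq.symm)) (key hab)))
      (key (hb.imp_right Adj.symm)))
  have h2 := (hX x hx y hy hxy).trans h1
  norm_num at h2

open Classical in
/-- Given a dominating set, there is one of at most the same size that differs from the
`3`-independent set `X` in at most `5k` vertices, where `k` is the size of the residual set: among
all dominating sets `D` with `|D| ≤ |X| + k` of at most the given size, one as close to `X` as
possible will do. -/
theorem IsDominatingSet.exists_near [Fintype V] (hX : G.IsRIndependent 3 X) {D₀ : Finset V}
    (hD₀ : G.IsDominatingSet D₀) :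
    ∃ D : Finset V, G.IsDominatingSet D ∧ D.card ≤ D₀.card ∧
      (X \ D).card + (D \ X).card ≤ 5 * (G.residual X).ncard := by
  set R : Finset V := Finset.univ.filter (· ∈ G.residual X) with hR
  have hk : (G.residual X).ncard = R.card := by
    rw [← Set.ncard_coe_finset]
    congr
    ext v
    simp [hR]
  rw [hk]
  obtain ⟨D₁, h1, h2, h3⟩ : ∃ D, G.IsDominatingSet D ∧ D.card ≤ D₀.card ∧
      D.card ≤ X.card + R.card := by
    rcases le_total D₀.card (X.card + R.card) with h | h
    · exact ⟨D₀, hD₀, le_rfl, h⟩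
    · refine ⟨X ∪ R, fun v => ?_, (Finset.card_union_le _ _).trans h, Finset.card_union_le _ _⟩
      by_cases hv : v ∈ R
      · exact ⟨v, by simp [hv], .inl rfl⟩
      · have : v ∈ G.closedNbhd X := by simpa [hR, residual] using hv
        rcases this with hv | ⟨x, hx, hv⟩
        · exact ⟨v, by simp [hv], .inl rfl⟩
        · exact ⟨x, by simp [hx], .inr hv.symm⟩
  obtain ⟨D, hD, hmin⟩ := Finset.exists_min_image
    (Finset.univ.filter fun D : Finset V => G.IsDominatingSet D ∧ D.card ≤ D₁.card)
    (fun D => (X \ D).card + (D \ X).card) ⟨D₁, by simp [h1]⟩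
  simp only [Finset.mem_filter, Finset.mem_univ, true_and] at hD hmin
  obtain ⟨hdom, hcard⟩ := hD
  refine ⟨D, hdom, hcard.trans h2, ?_⟩
  set N : V → Finset V := fun x => D.filter fun v => v = x ∨ G.Adj x v with hN
  have hN1 : ∀ x, 1 ≤ (N x).card := by
    intro x
    obtain ⟨u, hu, h⟩ := hdom x
    exact Finset.card_pos.2 ⟨u, by simp [hN, hu, h]⟩
  set X₂ := X.filter fun x => 2 ≤ (N x).card with hX₂
  have hX₂card : X.card + X₂.card ≤ D.card := by
    have hdisj : (X : Set V).PairwiseDisjoint N := by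
      intro x hx y hy hxy
      refine Finset.disjoint_left.2 fun a ha hb => hxy ?_
      simp only [hN, Finset.mem_filter] at ha hb
      exact hX.eq_of_touch hx hy ha.2 hb.2 (.inl rfl)
    calc X.card + X₂.card = ∑ x ∈ X, (1 + if 2 ≤ (N x).card then 1 else 0) := by
          simp [Finset.sum_add_distrib, hX₂]
      _ ≤ ∑ x ∈ X, (N x).card := by
          refine Finset.sum_le_sum fun x _ => ?_
          have := hN1 x
          split_ifs <;> omega
      _ = (X.biUnion N).card := (Finset.card_biUnion hdisj).symm
      _ ≤ D.card :=
          Finset.card_le_card (Finset.biUnion_subset.2 fun x _ => Finset.filter_subset _ _)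
  set X₁ := X.filter fun x => x ∉ D ∧ (N x).card = 1 with hX₁
  -- If `D` has a single vertex `d` in `N[x]` and `d ≠ x`, then replacing `d` by `x` gives a closer
  -- set, which by minimality is not dominating: `d` alone dominates some vertex of the residual.
  have key : ∀ x ∈ X₁, ∃ v ∈ R, ∃ d, (d = x ∨ G.Adj x d) ∧
      ∀ u ∈ D, (u = v ∨ G.Adj v u) → u = d := by
    intro x hx
    simp only [hX₁, Finset.mem_filter] at hx
    obtain ⟨hxX, hxD, hx1⟩ := hx
    obtain ⟨d, hd⟩ := Finset.card_eq_one.1 hx1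
    have hd' : d ∈ N x := by simp [hd]
    simp only [hN, Finset.mem_filter] at hd'
    obtain ⟨hdD, hdx⟩ := hd'
    have hdX : d ∉ X := by
      intro h
      have := hX.eq_of_touch hxX h hdx (.inl rfl) (.inl rfl)
      exact hxD (this ▸ hdD)
    have hlt : (X \ insert x (D.erase d)).card + (insert x (D.erase d) \ X).card <
        (X \ D).card + (D \ X).card := by
      refine add_lt_add_of_lt_of_le (Finset.card_lt_card ?_) (Finset.card_le_card ?_)
      · refine Finset.ssubset_iff_subset_ne.2 ⟨fun y hy => ?_, fun h => ?_⟩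
        · simp only [Finset.mem_sdiff, Finset.mem_insert, Finset.mem_erase, not_or, not_and] at hy ⊢
          exact ⟨hy.1, hy.2.2 fun h => hdX (h ▸ hy.1)⟩
        · have : x ∈ X \ D := by simp [hxX, hxD]
          rw [← h] at this
          simp at this
      · intro y hy
        simp only [Finset.mem_sdiff, Finset.mem_insert, Finset.mem_erase] at hy ⊢
        rcases hy with ⟨rfl | h, hyX⟩
        · exact absurd hxX hyX
        · exact ⟨h.2, hyX⟩
    have hnot : ¬ G.IsDominatingSet (insert x (D.erase d)) := by
      intro h
      refine (hmin _ ⟨h, ?_⟩).not_gt hlt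
      refine (Finset.card_insert_le _ _).trans ?_
      rw [Finset.card_erase_add_one hdD]
      exact hcard
    simp only [IsDominatingSet, not_forall, not_exists, not_and] at hnot
    obtain ⟨v, hv⟩ := hnot
    have hvd : ∀ u ∈ D, (u = v ∨ G.Adj v u) → u = d := by
      intro u hu huv
      by_contra hne
      exact hv u (by simp [hu, hne]) huv
    refine ⟨v, ?_, d, hdx, hvd⟩
    rw [hR, Finset.mem_filter]
    refine ⟨Finset.mem_univ _, fun hvN => ?_⟩
    obtain ⟨y, hy, hyv⟩ : ∃ y ∈ X, v = y ∨ G.Adj y v := by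
      rcases hvN with h | ⟨y, hy, h⟩
      · exact ⟨v, h, .inl rfl⟩
      · exact ⟨y, hy, .inr h⟩
    obtain ⟨u, hu, huv⟩ := hdom v
    obtain rfl := hvd u hu huv
    obtain rfl : x = y := hX.eq_of_touch hxX hy hdx hyv (huv.imp_right Adj.symm)
    exact hv x (by simp) (hyv.imp Eq.symm Adj.symm)
  choose! v hvR d hdx hvd using key
  have hX₁card : X₁.card ≤ R.card := by
    refine Finset.card_le_card_of_injOn v hvR fun x hx y hy hxy => ?_
    obtain ⟨u, hu, huv⟩ := hdom (v x)
    have e1 := hvd x hx u hu huv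
    have e2 := hvd y hy u hu (hxy ▸ huv)
    exact hX.eq_of_touch (Finset.mem_filter.1 hx).1 (Finset.mem_filter.1 hy).1 (hdx x hx)
      (hdx y hy) (.inl (e1.symm.trans e2))
  have hsub : X \ D ⊆ X₁ ∪ X₂ := by
    intro x hx
    rw [Finset.mem_sdiff] at hx
    have := hN1 x
    simp only [hX₁, hX₂, Finset.mem_union, Finset.mem_filter, hx.1, hx.2, not_false_eq_true,
      true_and]
    omega
  have h4 := (Finset.card_le_card hsub).trans (Finset.card_union_le _ _)
  have h5 := Finset.card_sdiff_add_card_inter X D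
  have h6 := Finset.card_sdiff_add_card_inter D X
  rw [Finset.inter_comm] at h6
  -- `|X \ D| ≤ 2k` by `h4`, and `|D \ X| = |D| - |X| + |X \ D| ≤ 3k`.
  omega

/-- The vertices of `D` together with the vertices that have no neighbour in `D`: a dominating set
that contains `D`, and `D` itself if `D` is dominating. -/
noncomputable def completion [Fintype V] (G : SimpleGraph V) (D : Finset V) : Finset V :=
  open Classical in Finset.univ.filter fun v => v ∈ D ∨ ¬∃ u ∈ D, G.Adj v u

/-- A graph has a dominating set of size `p` if and only if `p` is at most the number of vertices
and some set close to `X` has a completion of size at most `p`. -/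
theorem exists_isDominatingSet_card_eq_iff [Fintype V] [DecidableEq V] (hX : G.IsRIndependent 3 X)
    (p : ℕ) :
    (∃ D : Finset V, D.card = p ∧ G.IsDominatingSet D) ↔
      p ≤ Fintype.card V ∧ ∃ D : Finset V,
        (X \ D).card + (D \ X).card ≤ 5 * (G.residual X).ncard ∧ (G.completion D).card ≤ p := by
  constructor
  · rintro ⟨D₀, rfl, hD₀⟩
    refine ⟨Finset.card_le_univ _, ?_⟩
    obtain ⟨D, h1, h2, h3⟩ := hD₀.exists_near hX
    refine ⟨D, by convert h3, (Finset.card_le_card fun v hv => ?_).trans h2⟩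
    simp only [completion, Finset.mem_filter, Finset.mem_univ, true_and] at hv
    by_contra hvD
    obtain ⟨u, hu, h⟩ := h1 v
    rcases h with rfl | h
    · exact hvD hu
    · exact hv.elim hvD fun h' => h' ⟨u, hu, h⟩
  · rintro ⟨hp, D, -, hD⟩
    obtain ⟨D', h1, h2⟩ := Finset.exists_superset_card_eq hD hp
    refine ⟨D', h2, fun v => ?_⟩
    by_cases hv : ∃ u ∈ D, G.Adj v u
    · obtain ⟨u, hu, h⟩ := hv
      exact ⟨u, h1 (by simp [completion, hu]), .inr h⟩
    · exact ⟨v, h1 (by simp [completion, hv]), .inl rfl⟩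

end SimpleGraph

/-! ### The machine on encoded instances -/

namespace DomSearch

theorem zip_ofFn {α β : Type*} {n : ℕ} (a : Fin n → α) (b : Fin n → β) :
    (List.ofFn a).zip (List.ofFn b) = (List.finRange n).map fun i => (a i, b i) := by
  apply List.ext_getElem <;> simp

theorem countP_zip_ofFn {n : ℕ} (f : Bool × Bool → Bool) (a b : Fin n → Bool) :
    ((List.ofFn a).zip (List.ofFn b)).countP f =
      (Finset.univ.filter fun i => f (a i, b i) = true).card := by
  rw [zip_ofFn, List.countP_map, Finset.card_def, Finset.filter_val,
    ← Multiset.countP_eq_card_filter,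
    Fin.univ_def]
  simp [Function.comp_def]

/-- The characteristic word of a set of vertices. -/
def charWord {n : ℕ} (S : Finset (Fin n)) : List Bool := List.ofFn fun i => decide (i ∈ S)

theorem exists_eq_charWord {n : ℕ} {l : List Bool} (hl : l.length = n) :
    ∃ S : Finset (Fin n), l = charWord S := by
  subst hl
  refine ⟨Finset.univ.filter fun i => l.get i = true, ?_⟩
  simp [charWord]

@[simp] theorem length_charWord {n : ℕ} (S : Finset (Fin n)) : (charWord S).length = n := by
  simp [charWord]

open Classical in
/-- The rows of the adjacency matrix. -/
noncomputable def adjRows {n : ℕ} (G : SimpleGraph (Fin n)) : List (List Bool) :=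
  List.ofFn fun i => List.ofFn fun j => decide (G.Adj i j)

theorem meets_reverse {r D : List Bool} (h : r.length = D.length) :
    meets r.reverse D.reverse = meets r D := by
  change (List.zipWith Prod.mk r.reverse D.reverse).any _ = _
  rw [← List.reverse_zipWith h, List.any_reverse]
  rfl

open Classical in
theorem hits_adjRows {n : ℕ} (G : SimpleGraph (Fin n)) (S : Finset (Fin n)) :
    ((flipMat (adjRows G)).map (meets · (charWord S).reverse)).reverse =
      List.ofFn fun i => decide (∃ j ∈ S, G.Adj i j) := by
  have h : ∀ r ∈ adjRows G, meets r.reverse (charWord S).reverse = meets r (charWord S) := by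
    intro r hr
    obtain ⟨i, rfl⟩ := (List.mem_ofFn' _ _).1 hr
    exact meets_reverse (by simp)
  rw [flipMat, List.map_reverse, List.reverse_reverse, List.map_map]
  refine (List.map_congr_left h).trans ?_
  rw [adjRows, List.map_ofFn]
  congr 1
  funext i
  rw [Function.comp_apply, meets, charWord, zip_ofFn, List.any_map, Bool.eq_iff_iff]
  simp [and_comm]

theorem totalCost_charWord {n : ℕ} (G : SimpleGraph (Fin n)) (S : Finset (Fin n)) :
    totalCost (flipMat (adjRows G)) (charWord S).reverse = (G.completion S).card := by
  rw [totalCost, hits_adjRows, List.reverse_reverse, cost, charWord, countP_zip_ofFn,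
    SimpleGraph.completion]
  congr 1
  ext i
  simp

theorem missing_charWord {n : ℕ} (G : SimpleGraph (Fin n)) (X : Finset (Fin n)) :
    missing (charWord X) ((flipMat (adjRows G)).map (meets · (charWord X).reverse)).reverse =
      (G.residual X).ncard := by
  rw [hits_adjRows, missing, charWord, countP_zip_ofFn, ← Set.ncard_coe_finset]
  congr 1
  ext i
  simp [SimpleGraph.residual, SimpleGraph.closedNbhd, G.adj_comm i]

theorem countP_ne_charWord {n : ℕ} (X S : Finset (Fin n)) :
    ((charWord X).zip (charWord S)).countP (fun x => x.1 != x.2) =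
      (X \ S).card + (S \ X).card := by
  rw [charWord, charWord, countP_zip_ofFn, ← Finset.card_union_of_disjoint disjoint_sdiff_sdiff]
  congr 1
  ext i
  by_cases h1 : i ∈ X <;> by_cases h2 : i ∈ S <;> simp [h1, h2]

theorem encode_eq {r : ℕ} (I : DomSetInstance r) :
    I.encode = un I.n ++ none :: (((adjRows I.G).flatMap fun r => bits r ++ [none]) ++
      (bits (charWord I.X) ++ none :: bits (Computability.encodeNat I.p))) := by
  have h1 : (List.ofFn fun i => DomSetInstance.bits (I.G.Adj i) ++ [none]).flatten =
      (adjRows I.G).flatMap fun r => bits r ++ [none] := by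
    rw [List.flatMap_def, adjRows, List.map_ofFn]
    congr 2
    funext i
    simp [DomSetInstance.bits, List.map_ofFn, Function.comp_def]
  have h2 : DomSetInstance.bits (· ∈ I.X) = bits (charWord I.X) := by
    simp only [DomSetInstance.bits, charWord, List.map_ofFn, Function.comp_def]
    congr 1
    funext i
    congr
  rw [DomSetInstance.encode, h1, h2]
  simp

theorem length_encode {r : ℕ} (I : DomSetInstance r) :
    I.encode.length = I.n ^ 2 + 3 * I.n + 2 + (Computability.encodeNat I.p).length := by
  have h : ((adjRows I.G).flatMap fun r => bits r ++ [none]).length = I.n * (I.n + 1) := by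
    simp [adjRows, List.length_flatMap, List.map_ofFn, Function.comp_def]
  rw [encode_eq]
  simp only [List.length_append, List.length_cons, h, List.length_map, length_charWord,
    List.length_replicate]
  ring

/-- The machine for Dominating Set above `3`-independence. -/
noncomputable def solver : Turing.TM2ComputableAux (Option Bool) Bool := main.machine .inp .ans

theorem solver_answersWithin (I : DomSetInstance 3) :
    (dominatingSetAbove 3).AnswersWithin solver I
      (mainTime I.n (Computability.encodeNat I.p).length (5 * (I.G.residual I.X).ncard) + 1) := by
  classical
  have h := run_main (adjRows I.G) I.n
    (fun r hr => by obtain ⟨i, rfl⟩ := (List.mem_ofFn' _ _).1 hr; simp) (by simp [adjRows])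
    (charWord I.X) (by simp) (Computability.encodeNat I.p)
  rw [missing_charWord, ← encode_eq, binVal_encodeNat] at h
  set b := decide (I.p ≤ I.n) && anyFlip
    (fun D => decide (totalCost (flipMat (adjRows I.G)) D ≤ I.p)) [] (charWord I.X)
      (5 * (I.G.residual I.X).ncard) with hb
  have hyes : b = decide ((dominatingSetAbove 3).IsYes I) := by
    rw [Bool.eq_iff_iff, hb, Bool.and_eq_true, decide_eq_true_iff, decide_eq_true_iff, anyFlip_iff]
    refine Iff.trans ?_ (SimpleGraph.exists_isDominatingSet_card_eq_iff I.maximal.prop I.p).symm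
    rw [Fintype.card_fin]
    refine and_congr_right fun _ => ⟨?_, ?_⟩
    · rintro ⟨l, h1, h2, h3⟩
      obtain ⟨S, rfl⟩ := exists_eq_charWord (h1.trans (length_charWord _))
      rw [countP_ne_charWord] at h2
      rw [List.append_nil, totalCost_charWord, decide_eq_true_iff] at h3
      exact ⟨S, h2, h3⟩
    · rintro ⟨S, h2, h3⟩
      refine ⟨charWord S, by simp, ?_, ?_⟩
      · rwa [countP_ne_charWord]
      · rwa [List.append_nil, totalCost_charWord, decide_eq_true_iff]
  have hempty : Mem.empty.get = fun _ => [] := by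
    funext k
    cases k <;> rfl
  have h' := StackProg.Exec.outputs (p := main) (i := .inp) (o := .ans) (w := I.encode)
    (x := ansList b) (t := mainTime I.n (Computability.encodeNat I.p).length
      (5 * (I.G.residual I.X).ncard)) (by unfold ansList; split <;> simp) (by
        rw [← hempty, ← Mem.get_set, ← Mem.get_set]
        exact h)
  have hans : (!(ansList b).isEmpty) = b := by cases b <;> rfl
  rw [hans, hyes] at h'
  exact h'

/-- The constants and the polynomial factors go into the `9` of the exponent, as `2 ≤ N`. -/
theorem mainTime_le {n L N : ℕ} (k : ℕ) (hn : n + 1 ≤ N) (hL : L ≤ N) (hN : 2 ≤ N) :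
    mainTime n L (5 * k) + 1 ≤ N ^ (5 * k + 9) := by
  have h1 : (n + 1) ^ (5 * k) ≤ N ^ (5 * k) := Nat.pow_le_pow_left hn _
  have h2 : 1 ≤ N ^ (5 * k) := Nat.one_le_pow _ _ (by omega)
  have h3 : testTime n + 24 * n ≤ 39 * N ^ 2 := by
    unfold testTime
    nlinarith
  have h4 : 4 * n * L + 15 * n ^ 2 + 80 * n + 4 * L + 40 + 1 ≤ 72 * N ^ 2 := by
    have : n * L ≤ N * N := Nat.mul_le_mul (by omega) hL
    nlinarith
  have h5 : 2 ^ 7 ≤ N ^ 7 := Nat.pow_le_pow_left hN 7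
  calc mainTime n L (5 * k) + 1
      = (testTime n + 24 * n) * (n + 1) ^ (5 * k) +
          (4 * n * L + 15 * n ^ 2 + 80 * n + 4 * L + 40 + 1) * 1 := by
        rw [mainTime, dfsTime]
        ring
    _ ≤ 39 * N ^ 2 * N ^ (5 * k) + 72 * N ^ 2 * N ^ (5 * k) :=
        add_le_add (Nat.mul_le_mul h3 h1) (Nat.mul_le_mul h4 h2)
    _ = 111 * (N ^ 2 * N ^ (5 * k)) := by ring
    _ ≤ N ^ 7 * (N ^ 2 * N ^ (5 * k)) := Nat.mul_le_mul_right _ (by omega)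
    _ = N ^ (5 * k + 9) := by ring

end DomSearch

theorem ParamProblem.AnswersWithin.mono {P : ParamProblem}
    {M : Turing.TM2ComputableAux P.Alphabet Bool} {I : P.Instance} {t t' : ℕ}
    (h : P.AnswersWithin M I t) (ht : t ≤ t') : P.AnswersWithin M I t' := by
  obtain ⟨h⟩ := h
  exact ⟨⟨h.1, h.2.trans ht⟩⟩

open DomSearch in
theorem mainTheorem8 :
    ∃ (M : Turing.TM2ComputableAux (dominatingSetAbove 3).Alphabet Bool) (f : ℕ → ℕ),
      (dominatingSetAbove 3).IsXPAlgorithm M f ∧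
      ∀ I : DomSetInstance 3, 2 ≤ I.n → I.p ≤ I.n →
        (dominatingSetAbove 3).AnswersWithin M I (I.n ^ f (I.G.residual I.X).ncard) := by
  have hw : ∀ I : DomSetInstance 3, (dominatingSetAbove 3).AnswersWithin solver I
      (I.encode.length ^ (5 * (I.G.residual I.X).ncard + 9)) := by
    intro I
    have hlen := length_encode I
    exact (solver_answersWithin I).mono
      (mainTime_le _ (by nlinarith) (by nlinarith) (by nlinarith))
  -- The factor `4` in the exponent comes from `|w| ≤ n ^ 4` for `2 ≤ n` and `p ≤ n`.
  refine ⟨solver, fun k => 20 * k + 36, ⟨?_, ?_, fun I => ?_⟩, fun I hn hp => ?_⟩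
  · exact (Primrec.nat_add.comp (Primrec.nat_mul.comp (Primrec.const 20) Primrec.id)
      (Primrec.const 36)).to_comp
  · exact StackProg.finite_machine main .inp .ans
  · have hlen := length_encode I
    refine (hw I).mono (le_add_right (Nat.pow_le_pow_right ?_ ?_))
    · show 0 < I.encode.length
      omega
    · show 5 * (I.G.residual I.X).ncard + 9 ≤ 20 * (I.G.residual I.X).ncard + 36
      omega
  · have hlen : I.encode.length ≤ I.n ^ 4 := by
      rw [length_encode]
      have h1 := length_encodeNat_le I.p
      have h2 : I.n ^ 4 = I.n ^ 2 * I.n ^ 2 := by ring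
      have h3 : 2 * I.n ≤ I.n ^ 2 := by nlinarith
      nlinarith
    refine (hw I).mono ((Nat.pow_le_pow_left hlen _).trans_eq ?_)
    rw [← pow_mul]
    ring_nf
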